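/- Let $\mathsf{Nat}$ be the category with objects $n=\{0,\dots,n-1\}$ for $n\in\mathbb N$ and with the strictly increasing functions as morphisms, and let $\mathsf{LO}$ be the category of linear orders and order embeddings. A \emph{Goodstein dilator} is a functor $D:\mathsf{Nat}\to\mathsf{LO}$ such that (a) each order $D(n)$ is equal to an initial segment of $\mathbb N$ with the usual order, (b) $D$ preserves pullbacks, and (c) $0\in D(0)$, and $D(\mathrm{emp}_n)(0)=0$ for the empty function $\mathrm{emp}_n:0\to n$ and every $n$. In second order arithmetic, $D$ is coded by a set of natural numbers. Let $\operatorname{supp}_n:D(n)\to[n]^{<\omega}$ be the (unique) natural transformation from $D$ to the finite powerset functor such that $\operatorname{supp}_n(\sigma)\subseteq\operatorname{rng}(f)$ implies $\sigma\in\operatorname{rng}(D(f))$ for all morphisms $f:m\to n$ and all $\sigma\in D(n)$. For a linear order $X$, let $\overline D(X)$ be the set of pairs $(a,\sigma)$ of a finite set $a\subseteq X$ and an element $\sigma\in D(|a|)$ with $\operatorname{supp}_{|a|}(\sigma)=\{0,\dots,|a|-1\}$, ordered by $$(a,\sigma)<(b,\tau)\quad\Leftrightarrow\quad D(|\iota_a|)(\sigma)<D(|\iota_b|)(\tau)\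 \text{ in } D(|a\cup b|),$$ where $|\iota_a|:|a|\to|a\cup b|$ and $|\iota_b|:|b|\to|a\cup b|$ are the morphisms of $\mathsf{Nat}$ that correspond to the inclusions $a\hookrightarrow a\cup b$ and $b\hookrightarrow a\cup b$ under the increasing enumerations of these finite sets. For a non-decreasing function $b:\mathbb N\to\mathbb N$ with $b(0)>0$ and for $m\in D(b(0))$, define the Goodstein sequence (without coefficient changes) by $G^D_{b,m}(0)=m$, and $G^D_{b,m}(i+1)=0$ if $G^D_{b,m}(i)=0$, and $G^D_{b,m}(i+1)=D(c_i)(G^D_{b,m}(i))-1$ otherwise, where $c_i:b(i)\to b(i+1)$ is the inclusion $c_i(n)=n$. \textbf{Theorem.} The theory $\mathbf{RCA}_0$ proves (equivalently, it holds in every model of $\mathbf{RCA}_0$) that the following are equivalent for any Goodstein dilator $D$: \begin{enumerate} \item[(i)] for any non-decreasing function $b:\mathbb N\to\mathbb N$ with $b(0)>0$ and any $m\in D(b(0))$, there is an $i\in\mathbb N$ with $G^D_{b,m}(i)=0$; \item[(ii)] the linear order $\overline D(\mathbb N)$ is well founded (i.e. it contains no infinite descending sequence). \end{enumerate} -/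

import Mathlib

universe u

namespace SOA

/-! ### The language of second order arithmetic and the theory `RCA₀`

A structure for the two-sorted language of second order arithmetic consists of a first order part
`N` with `0, 1, +, *, <`, and of a family `S : Set (Set N)` of subsets of `N`, which is the range
of the set quantifiers (general, i.e. Henkin, semantics; `N` may be nonstandard).
`RCA₀` proves a sentence if and only if the sentence holds in every model of `RCA₀`
(completeness theorem).
All notions defined below are relative to such a structure, and they only quantify over elements
of `N` and over members of `S`. -/

/-- The first order part of a structure for the language of second order arithmetic
(the axioms are stated in `ModelsRCA0`). -/
class NumStr (N : Type u) extends Zero N, One N, Add N, Mul N, LT N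

/-- Number terms; `var i` is a de Bruijn index. -/
inductive NumTerm : Type
  | var (i : ℕ) : NumTerm
  | zero : NumTerm
  | one : NumTerm
  | add (s t : NumTerm) : NumTerm
  | mul (s t : NumTerm) : NumTerm

/-- Bounded (`Σ⁰₀`) formulas with number and set variables. In `ball t φ`, i.e. `∀ x < t, φ`, the
variable `x` has index `0` in `φ`, and the indices of the other number variables are shifted
(so that `x` does not occur in `t`). -/
inductive BddFormula : Type
  | eq (s t : NumTerm) : BddFormula
  | lt (s t : NumTerm) : BddFormula
  | mem (t : NumTerm) (X : ℕ) : BddFormula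
  | neg (φ : BddFormula) : BddFormula
  | and (φ ψ : BddFormula) : BddFormula
  | ball (t : NumTerm) (φ : BddFormula) : BddFormula

section

variable {N : Type u} [NumStr N]

/-- Put the value `x` in front of a variable assignment. -/
def push (x : N) (e : ℕ → N) : ℕ → N
  | 0 => x
  | i + 1 => e i

def NumTerm.val (e : ℕ → N) : NumTerm → N
  | .var i => e i
  | .zero => 0
  | .one => 1
  | .add s t => s.val e + t.val e
  | .mul s t => s.val e * t.val e

/-- Satisfaction of bounded formulas, for values `e i` of the number variables and values `E i` of
the set variables. -/
def BddFormula.Holds (E : ℕ → Set N) : BddFormula → (ℕ → N) → Prop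
  | .eq s t, e => s.val e = t.val e
  | .lt s t, e => s.val e < t.val e
  | .mem t X, e => t.val e ∈ E X
  | .neg φ, e => ¬ φ.Holds E e
  | .and φ ψ, e => φ.Holds E e ∧ ψ.Holds E e
  | .ball t φ, e => ∀ x : N, x < t.val e → φ.Holds E (push x e)

/-- The `Σ⁰₁` formula `∃ y, φ(y, n)` with parameters `e` and `E`. -/
def SigmaOne (φ : BddFormula) (E : ℕ → Set N) (e : ℕ → N) (n : N) : Prop :=
  ∃ y : N, φ.Holds E (push y (push n e))

/-- The `Π⁰₁` formula `∀ y, φ(y, n)` with parameters `e` and `E`. -/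
def PiOne (φ : BddFormula) (E : ℕ → Set N) (e : ℕ → N) (n : N) : Prop :=
  ∀ y : N, φ.Holds E (push y (push n e))

/-- `(N, S)` is a model of `RCA₀`: the basic axioms, induction for `Σ⁰₁` formulas and comprehension
for `Δ⁰₁` formulas (with number and set parameters). -/
structure ModelsRCA0 (S : Set (Set N)) : Prop where
  /-- the range of the set variables is nonempty -/
  nonempty : S.Nonempty
  succ_ne_zero : ∀ n : N, n + 1 ≠ 0
  succ_inj : ∀ m n : N, m + 1 = n + 1 → m = n
  add_zero : ∀ m : N, m + 0 = m
  add_succ : ∀ m n : N, m + (n + 1) = (m + n) + 1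
  mul_zero : ∀ m : N, m * 0 = 0
  mul_succ : ∀ m n : N, m * (n + 1) = m * n + m
  not_lt_zero : ∀ m : N, ¬ m < 0
  lt_succ : ∀ m n : N, m < n + 1 ↔ (m < n ∨ m = n)
  sigmaOne_induction : ∀ (φ : BddFormula) (E : ℕ → Set N) (e : ℕ → N), (∀ i, E i ∈ S) →
    SigmaOne φ E e 0 → (∀ n : N, SigmaOne φ E e n → SigmaOne φ E e (n + 1)) →
    ∀ n : N, SigmaOne φ E e n
  deltaOne_comprehension : ∀ (φ ψ : BddFormula) (E : ℕ → Set N) (e : ℕ → N), (∀ i, E i ∈ S) →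
    (∀ n : N, SigmaOne φ E e n ↔ PiOne ψ E e n) →
    ∃ X ∈ S, ∀ n : N, n ∈ X ↔ SigmaOne φ E e n

/-! ### Coding of pairs, finite sets, functions -/

/-- The code of an ordered pair. -/
def pair (x y : N) : N := (x + y) * (x + y) + x

/-- `t` has the form `(k, (m, n))`. -/
def IsTriple (t : N) : Prop := ∃ k m n : N, t = pair k (pair m n)

/-- The triple `(k, (m, n))` represents the finite set of all `i < k` such that `m(i+1)+1`
divides `n`. The relation `FinMem i t` says that `i` lies in the finite set represented by `t`. -/
def FinMem (i t : N) : Prop :=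
  ∃ k m n : N, t = pair k (pair m n) ∧ i < k ∧ ∃ q : N, n = (m * (i + 1) + 1) * q

/-- `t` is the code of a finite set, i.e. the least triple that represents it. -/
def IsFinSet (t : N) : Prop :=
  IsTriple t ∧ ∀ t' : N, t' < t → IsTriple t' → ¬ ∀ i : N, FinMem i t' ↔ FinMem i t

/-- `s` codes a finite sequence of length `c`, i.e. a function with domain `{0,…,c-1}`, as the
finite set of pairs that constitutes its graph. -/
def IsFinSeq (c s : N) : Prop :=
  IsFinSet s ∧ (∀ z : N, FinMem z s → ∃ i j : N, z = pair i j ∧ i < c) ∧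
    ∀ i : N, i < c → ∃! j : N, FinMem (pair i j) s

/-- The set `F` is (the graph of) a function from the numbers to the numbers. -/
def IsFun (F : Set N) : Prop :=
  (∀ z ∈ F, ∃ x y : N, z = pair x y) ∧ ∀ x : N, ∃! y : N, pair x y ∈ F

/-! ### Linear orders and embeddings -/

/-- `r` is a strict linear order with underlying set `A`. -/
def IsLinOrd (A : N → Prop) (r : N → N → Prop) : Prop :=
  (∀ x y, r x y → A x ∧ A y) ∧ (∀ x, ¬ r x x) ∧ (∀ x y z, r x y → r y z → r x z) ∧
    ∀ x y, A x → A y → r x y ∨ x = y ∨ r y x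

/-- The set `G` is (the graph of) an order embedding of `(A, r)` into `(B, r')`. -/
def IsEmb (A : N → Prop) (r : N → N → Prop) (B : N → Prop) (r' : N → N → Prop) (G : Set N) :
    Prop :=
  (∀ z ∈ G, ∃ x y : N, z = pair x y ∧ A x ∧ B y) ∧ (∀ x, A x → ∃! y : N, pair x y ∈ G) ∧
    ∀ x x' y y' : N, pair x y ∈ G → pair x' y' ∈ G → r x x' → r' y y'

/-- A set `L` codes a linear order via its elements `(0, x)` for `x` in the order and
`(1, (x, y))` for `x` smaller than `y`. -/
def OrdMem (L : Set N) (x : N) : Prop := pair 0 x ∈ L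

def OrdLt (L : Set N) (x y : N) : Prop := pair 1 (pair x y) ∈ L

/-! ### The category of natural numbers -/

/-- `f` codes a morphism `m → n` in the category of natural numbers, i.e. a strictly increasing
function from `{0,…,m-1}` to `{0,…,n-1}`, as `f = (m, (n, s))` where `s` codes its graph. -/
def IsMor (m n f : N) : Prop :=
  ∃ s : N, f = pair m (pair n s) ∧ IsFinSeq m s ∧
    (∀ i j : N, FinMem (pair i j) s → j < n) ∧
    ∀ i i' j j' : N, FinMem (pair i j) s → FinMem (pair i' j') s → i < i' → j < j'

/-- `f(i) = j`, for the code `f` of a morphism. -/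
def App (f i j : N) : Prop := ∃ m n s : N, f = pair m (pair n s) ∧ FinMem (pair i j) s

/-- `f` is an identity or, more generally, an inclusion: `f(i) = i` for all arguments `i`. -/
def IsIncl (f : N) : Prop := ∀ i j : N, App f i j → j = i

/-- `h = g ∘ f`, for codes of morphisms `f : l → m`, `g : m → n`, `h : l → n`. -/
def IsComp (f g h : N) : Prop := ∀ i j k : N, App f i j → App g j k → App h i k

/-- The morphisms `p : l → m`, `p' : l → m'`, `e : m → n`, `e' : m' → n` form a pullback square
in the category of natural numbers. -/
def IsNatPullback (l m m' n p p' e e' : N) : Prop :=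
  IsMor l m p ∧ IsMor l m' p' ∧ IsMor m n e ∧ IsMor m' n e' ∧
  (∃ d : N, IsMor l n d ∧ IsComp p e d ∧ IsComp p' e' d) ∧
  ∀ k j j' : N, IsMor k m j → IsMor k m' j' →
    (∃ d : N, IsMor k n d ∧ IsComp j e d ∧ IsComp j' e' d) →
    ∃! h : N, IsMor k l h ∧ IsComp h p j ∧ IsComp h p' j'

/-! ### Functors from natural numbers to linear orders, Goodstein dilators

A functor `D` is coded by a set with elements `(0, (n, σ))` for `σ ∈ D(n)`, `(1, (n, (σ, τ)))` for
`σ < τ` in `D(n)`, and `(2, (f, (σ, τ)))` for `D(f)(σ) = τ`. -/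

/-- `σ ∈ D(n)` -/
def ObjMem (D : Set N) (n σ : N) : Prop := pair 0 (pair n σ) ∈ D

/-- `σ < τ` in `D(n)` -/
def ObjLt (D : Set N) (n σ τ : N) : Prop := pair 1 (pair n (pair σ τ)) ∈ D

/-- `D(f)(σ) = τ` -/
def MapTo (D : Set N) (f σ τ : N) : Prop := pair (1 + 1) (pair f (pair σ τ)) ∈ D

/-- `D` codes a functor from the category of natural numbers to the category of linear orders. -/
structure IsFunctor (D : Set N) : Prop where
  linOrd : ∀ n : N, IsLinOrd (ObjMem D n) (ObjLt D n)
  map_mem : ∀ m n f σ τ : N, IsMor m n f → MapTo D f σ τ → ObjMem D m σ ∧ ObjMem D n τ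
  map_total : ∀ m n f σ : N, IsMor m n f → ObjMem D m σ → ∃! τ : N, MapTo D f σ τ
  map_lt : ∀ m n f σ σ' τ τ' : N, IsMor m n f → MapTo D f σ τ → MapTo D f σ' τ' →
    ObjLt D m σ σ' → ObjLt D n τ τ'
  map_id : ∀ n f σ : N, IsMor n n f → IsIncl f → ObjMem D n σ → MapTo D f σ σ
  map_comp : ∀ l m n f g h σ τ ρ : N, IsMor l m f → IsMor m n g → IsMor l n h → IsComp f g h →
    MapTo D f σ τ → MapTo D g τ ρ → MapTo D h σ ρ

/-- `D(e) ∘ G = D(e') ∘ G'`, for functions `G` and `G'` with the same domain. -/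
def AgreeAfter (D : Set N) (e e' : N) (G G' : Set N) : Prop :=
  ∀ x y y' τ : N, pair x y ∈ G → pair x y' ∈ G' → (MapTo D e y τ ↔ MapTo D e' y' τ)

/-- `D(p) ∘ H = G`, for functions `H` and `G` with the same domain. -/
def FactorsAs (D : Set N) (p : N) (H G : Set N) : Prop :=
  ∀ x y z : N, pair x y ∈ H → pair x z ∈ G → MapTo D p y z

/-- The images of `p : l → m`, `p' : l → m'`, `e : m → n`, `e' : m' → n` under the functor `D` have
the universal property of a pullback square in the category of linear orders. (The image of a
commutative square commutes by functoriality.) -/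
def IsOrdPullback (S : Set (Set N)) (D : Set N) (l m m' p p' e e' : N) : Prop :=
  ∀ L ∈ S, IsLinOrd (OrdMem L) (OrdLt L) →
    ∀ G ∈ S, ∀ G' ∈ S,
      IsEmb (OrdMem L) (OrdLt L) (ObjMem D m) (ObjLt D m) G →
      IsEmb (OrdMem L) (OrdLt L) (ObjMem D m') (ObjLt D m') G' →
      AgreeAfter D e e' G G' →
      ∃! H : Set N, H ∈ S ∧ IsEmb (OrdMem L) (OrdLt L) (ObjMem D l) (ObjLt D l) H ∧
        FactorsAs D p H G ∧ FactorsAs D p' H G'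

/-- `D` codes a Goodstein dilator. -/
structure IsGoodsteinDilator (S : Set (Set N)) (D : Set N) : Prop where
  isFunctor : IsFunctor D
  /-- the underlying set of each `D(n)` is an initial segment of the natural numbers … -/
  initial : ∀ n σ τ : N, ObjMem D n σ → τ < σ → ObjMem D n τ
  /-- … with the usual order -/
  usual_order : ∀ n σ τ : N, ObjMem D n σ → ObjMem D n τ → (ObjLt D n σ τ ↔ σ < τ)
  preserves_pullbacks : ∀ l m m' n p p' e e' : N, IsNatPullback l m m' n p p' e e' →
    IsOrdPullback S D l m m' p p' e e'
  zero_mem : ObjMem D 0 0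
  /-- the empty morphism `0 → b` maps zero to zero -/
  map_zero : ∀ b f : N, IsMor 0 b f → MapTo D f 0 0

/-! ### Supports and the extension of a Goodstein dilator to linear orders -/

/-- `supp_n(σ) = a`, where a family of functions `supp_n` from `D(n)` to the finite subsets of
`{0,…,n-1}` is coded by the set `U` of all `(n, (σ, a))` with `supp_n(σ) = a`. -/
def SuppTo (U : Set N) (n σ a : N) : Prop := pair n (pair σ a) ∈ U

/-- `U` codes a natural transformation from `D` to the finite powerset functor such that
`supp_n(σ) ⊆ rng(f)` implies `σ ∈ rng(D(f))`. -/
structure IsSupport (D U : Set N) : Prop where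
  total : ∀ n σ : N, ObjMem D n σ → ∃! a : N, SuppTo U n σ a
  finSubset : ∀ n σ a : N, ObjMem D n σ → SuppTo U n σ a →
    IsFinSet a ∧ ∀ i : N, FinMem i a → i < n
  natural : ∀ m n f σ τ a a' : N, IsMor m n f → MapTo D f σ τ → SuppTo U m σ a → SuppTo U n τ a' →
    ∀ j : N, FinMem j a' ↔ ∃ i : N, FinMem i a ∧ App f i j
  range : ∀ m n f σ a : N, IsMor m n f → ObjMem D n σ → SuppTo U n σ a →
    (∀ j : N, FinMem j a → ∃ i : N, App f i j) → ∃ ρ : N, MapTo D f ρ σ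

/-- `s` codes the increasing enumeration `{0,…,c-1} ≅ a` of the finite set `a`, with respect to the
order `r`; in particular `c` is the cardinality of `a`. -/
def IsEnum (r : N → N → Prop) (a c s : N) : Prop :=
  IsFinSet a ∧ IsFinSeq c s ∧ (∀ x : N, FinMem x a ↔ ∃ i : N, FinMem (pair i x) s) ∧
    ∀ i i' x x' : N, FinMem (pair i x) s → FinMem (pair i' x') s → i < i' → r x x'

/-- `c = |a|` -/
def IsCard (r : N → N → Prop) (a c : N) : Prop := ∃ s : N, IsEnum r a c s

/-- `f = |ι| : |a| → |b|`, where `ι` is the inclusion of a finite set `a` into a finite set `b`. -/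
def IsInclMor (r : N → N → Prop) (a b f : N) : Prop :=
  ∃ c d s t : N, IsEnum r a c s ∧ IsEnum r b d t ∧ IsMor c d f ∧
    ∀ i j x : N, App f i j → FinMem (pair i x) s → FinMem (pair j x) t

/-- `u = a ∪ b` for codes of finite sets. -/
def IsUnion (a b u : N) : Prop := IsFinSet u ∧ ∀ x : N, FinMem x u ↔ FinMem x a ∨ FinMem x b

/-- Underlying set of the extension of `D` at the linear order `(A, r)`: the set of pairs `(a, σ)`
of a finite `a ⊆ A` and a `σ ∈ D(|a|)` with `supp_{|a|}(σ) = {0,…,|a|-1}`. -/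
def ExtMem (D U : Set N) (A : N → Prop) (r : N → N → Prop) (z : N) : Prop :=
  ∃ a σ c w : N, z = pair a σ ∧ IsFinSet a ∧ (∀ x : N, FinMem x a → A x) ∧ IsCard r a c ∧
    ObjMem D c σ ∧ SuppTo U c σ w ∧ ∀ i : N, FinMem i w ↔ i < c

/-- Order relation on the extension of `D` at a linear order with order relation `r`:
`(a, σ) < (b, τ)` if and only if `D(|ι|)(σ) < D(|ι'|)(τ)` holds in `D(|a ∪ b|)`, for the inclusions
`ι : a → a ∪ b` and `ι' : b → a ∪ b`. -/
def ExtLt (D : Set N) (r : N → N → Prop) (z z' : N) : Prop :=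
  ∃ a σ b τ u d f g σ' τ' : N, z = pair a σ ∧ z' = pair b τ ∧ IsUnion a b u ∧ IsCard r u d ∧
    IsInclMor r a u f ∧ IsInclMor r b u g ∧ MapTo D f σ σ' ∧ MapTo D g τ τ' ∧ ObjLt D d σ' τ'

/-- The order relation `r` on `A` is well founded: there is no infinite descending sequence. -/
def IsWellFounded (S : Set (Set N)) (A : N → Prop) (r : N → N → Prop) : Prop :=
  ¬ ∃ F ∈ S, IsFun F ∧ (∀ i z : N, pair i z ∈ F → A z) ∧
    ∀ i z z' : N, pair i z ∈ F → pair (i + 1) z' ∈ F → r z' z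

/-- The extension of `D`, formed with the (unique) support functions of `D`, has a well founded
value on the order `ℕ` of all natural numbers (of the structure). -/
def ExtNatWellFounded (S : Set (Set N)) (D : Set N) : Prop :=
  ∃ U ∈ S, IsSupport D U ∧
    IsWellFounded S (ExtMem D U (fun _ => True) (fun x y => x < y)) (ExtLt D (fun x y => x < y))

/-! ### Goodstein sequences without coefficient changes -/

/-- `B` is (the graph of) a non-decreasing function `b` from numbers to numbers with `b(0) > 0`. -/
def IsBase (B : Set N) : Prop :=
  IsFun B ∧ (∀ i j x y : N, i < j → pair i x ∈ B → pair j y ∈ B → (x < y ∨ x = y)) ∧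
    ∀ x : N, pair 0 x ∈ B → 0 < x

/-- `G` is the Goodstein sequence for `D`, the base change `B` and the start value `k`: we have
`G(0) = k`, and `G(i+1)` is `0` if `G(i) = 0` and `D(c)(G(i)) - 1` otherwise, where `c` is the
inclusion of `{0,…,b(i)-1}` into `{0,…,b(i+1)-1}`. -/
def IsGoodsteinSeq (D B : Set N) (k : N) (G : Set N) : Prop :=
  IsFun G ∧ pair 0 k ∈ G ∧ ∀ i x y : N, pair i x ∈ G → pair (i + 1) y ∈ G →
    (x = 0 → y = 0) ∧
    (x ≠ 0 → ∃ u v c τ : N, pair i u ∈ B ∧ pair (i + 1) v ∈ B ∧ IsMor u v c ∧ IsIncl c ∧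
      MapTo D c x τ ∧ τ = y + 1)

/-- For any base change `b` and any `k ∈ D(b(0))`, the Goodstein sequence reaches zero. -/
def GoodsteinTerminates (S : Set (Set N)) (D : Set N) : Prop :=
  ∀ B ∈ S, IsBase B → ∀ u k : N, pair 0 u ∈ B → ObjMem D u k →
    ∃ G ∈ S, IsGoodsteinSeq D B k G ∧ ∃ i : N, pair i 0 ∈ G

end

end SOA

/-!
Call functions `b` and `e` a descent if `b` is a non-decreasing base, `e(i) ∈ D(b(i))`, and
`e(i+1) < D(c_i)(e(i))` for the inclusions `c_i : b(i) → b(i+1)`. Both statements of the theorem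
are equivalent to the non-existence of descents.

A Goodstein sequence that avoids zero is a descent, since it satisfies
`G(i+1) + 1 = D(c_i)(G(i))`. For the same reason it is the slowest one: by induction, a descent
`e` is dominated by the Goodstein sequence with base `b` and start value `e(0)`, while the entries
of a descent are positive because `D(c_i)(0) = 0`.

An element of the extension is a pair `(a, σ)` of a finite set `a` of numbers and a suitable
`σ ∈ D(|a|)`. If `n` bounds `a`, the inclusion `|a| → n` sends `σ` into `D(n)`, and the order of
the extension can be computed in `D(n)`. So a descending sequence in the extension becomes a
descent once `b(i)` bounds the finite set of its `i`-th entry. Conversely, the existence of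
supports allows to write each `e(i)` as the image of an element of the extension.

Supports exist because `D` preserves pullbacks: if `σ ∈ D(n)` lies in the range of `D(f)` and of
`D(g)`, it lies in the range of `D(h)` for any `h` whose range is the intersection of the ranges of
`f` and `g`. Comprehension yields the set of those `i < n` that cannot be avoided, and induction
shows that avoiding all other elements one by one is the same as avoiding them simultaneously.
-/

universe v w

namespace SOA

/-! ### Terms and bounded formulas -/

instance : Zero NumTerm := ⟨.zero⟩
instance : One NumTerm := ⟨.one⟩
instance : Add NumTerm := ⟨.add⟩
instance : Mul NumTerm := ⟨.mul⟩

/-- Disjunction of bounded formulas. -/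
def BddFormula.or (φ ψ : BddFormula) : BddFormula := .neg (.and (.neg φ) (.neg ψ))

/-- Implication of bounded formulas. -/
def BddFormula.imp (φ ψ : BddFormula) : BddFormula := .neg (.and φ (.neg ψ))

theorem BddFormula.holds_or {N : Type u} [NumStr N] {φ ψ : BddFormula} {E : ℕ → Set N}
    {e : ℕ → N} : (φ.or ψ).Holds E e ↔ φ.Holds E e ∨ ψ.Holds E e :=
  or_iff_not_and_not.symm

theorem BddFormula.holds_imp {N : Type u} [NumStr N] {φ ψ : BddFormula} {E : ℕ → Set N}
    {e : ℕ → N} : (φ.imp ψ).Holds E e ↔ (φ.Holds E e → ψ.Holds E e) :=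
  not_and_not_right

/-- A model of `RCA₀` with first order part `N`, together with the range of its set quantifiers. -/
class Model (N : Type u) extends NumStr N where
  sets : Set (Set N)
  models : ModelsRCA0 sets

namespace Model

variable {N : Type u} [Model N]

/-! ### Arithmetic in a model -/

theorem exists_induction {P : N → N → Prop} (φ : BddFormula) (e : ℕ → N) (E : ℕ → Set N)
    (hE : ∀ i, E i ∈ sets (N := N)) (h : ∀ n y, φ.Holds E (push y (push n e)) ↔ P n y)
    (zero : ∃ y, P 0 y) (succ : ∀ n, (∃ y, P n y) → ∃ y, P (n + 1) y) (n : N) : ∃ y, P n y := by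
  have key : ∀ n, SigmaOne φ E e n ↔ ∃ y, P n y := fun n => exists_congr (h n)
  have induction := models.sigmaOne_induction φ E e hE
  simp only [key] at induction
  exact induction zero succ n

theorem arith_exists_induction {P : N → N → Prop} (φ : BddFormula) (e : ℕ → N)
    (h : ∀ E n y, φ.Holds E (push y (push n e)) ↔ P n y)
    (zero : ∃ y, P 0 y) (succ : ∀ n, (∃ y, P n y) → ∃ y, P (n + 1) y) (n : N) : ∃ y, P n y :=
  have ⟨A, hA⟩ := (models (N := N)).nonempty
  exists_induction φ e (fun _ => A) (fun _ => hA) (h _) zero succ n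

@[elab_as_elim]
theorem arith_induction {P : N → Prop} (φ : BddFormula) (e : ℕ → N)
    (h : ∀ E n y, φ.Holds E (push y (push n e)) ↔ P n)
    (zero : P 0) (succ : ∀ n, P n → P (n + 1)) (n : N) : P n :=
  have ⟨_, hn⟩ := arith_exists_induction φ e h ⟨0, zero⟩ (fun n ⟨_, hn⟩ => ⟨0, succ n hn⟩) n
  hn

protected theorem add_zero (a : N) : a + 0 = a := models.add_zero a

protected theorem add_succ (a b : N) : a + (b + 1) = a + b + 1 := models.add_succ a b

protected theorem mul_zero (a : N) : a * 0 = 0 := models.mul_zero a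

protected theorem mul_succ (a b : N) : a * (b + 1) = a * b + a := models.mul_succ a b

protected theorem zero_add (n : N) : 0 + n = n :=
  arith_induction (.eq (0 + .var 1) (.var 1)) (fun _ => 0) (fun _ _ _ => Iff.rfl)
    (Model.add_zero 0) (fun n hn => by rw [Model.add_succ, hn]) n

protected theorem succ_add (m n : N) : m + 1 + n = m + n + 1 :=
  arith_induction (.eq (.var 2 + 1 + .var 1) (.var 2 + .var 1 + 1)) (fun _ => m)
    (fun _ _ _ => Iff.rfl) (by simp only [Model.add_zero])
    (fun n hn => by rw [Model.add_succ, hn, Model.add_succ]) n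

protected theorem add_comm (m n : N) : m + n = n + m :=
  arith_induction (.eq (.var 2 + .var 1) (.var 1 + .var 2)) (fun _ => m)
    (fun _ _ _ => Iff.rfl) (by rw [Model.add_zero, Model.zero_add])
    (fun n hn => by rw [Model.add_succ, hn, Model.succ_add]) n

protected theorem add_assoc (a b n : N) : a + b + n = a + (b + n) :=
  arith_induction (.eq (.var 2 + .var 3 + .var 1) (.var 2 + (.var 3 + .var 1)))
    (push a fun _ => b) (fun _ _ _ => Iff.rfl) (by simp only [Model.add_zero])
    (fun n hn => by rw [Model.add_succ, hn, Model.add_succ, Model.add_succ]) n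

instance instAddCommMonoid : AddCommMonoid N where
  add_assoc := Model.add_assoc
  zero_add := Model.zero_add
  add_zero := Model.add_zero
  add_comm := Model.add_comm
  nsmul := nsmulRec

protected theorem zero_mul (n : N) : 0 * n = 0 :=
  arith_induction (.eq (0 * .var 1) 0) (fun _ => 0) (fun _ _ _ => Iff.rfl)
    (Model.mul_zero 0) (fun n hn => by rw [Model.mul_succ, hn, add_zero]) n

protected theorem succ_mul (m n : N) : (m + 1) * n = m * n + n :=
  arith_induction (.eq ((.var 2 + 1) * .var 1) (.var 2 * .var 1 + .var 1)) (fun _ => m)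
    (fun _ _ _ => Iff.rfl) (by simp only [Model.mul_zero, add_zero])
    (fun n hn => by rw [Model.mul_succ, hn, Model.mul_succ]; ac_rfl) n

protected theorem mul_comm (m n : N) : m * n = n * m :=
  arith_induction (.eq (.var 2 * .var 1) (.var 1 * .var 2)) (fun _ => m)
    (fun _ _ _ => Iff.rfl) (by rw [Model.mul_zero, Model.zero_mul])
    (fun n hn => by rw [Model.mul_succ, hn, Model.succ_mul]) n

protected theorem mul_add (a b n : N) : a * (b + n) = a * b + a * n :=
  arith_induction (.eq (.var 2 * (.var 3 + .var 1)) (.var 2 * .var 3 + .var 2 * .var 1))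
    (push a fun _ => b) (fun _ _ _ => Iff.rfl) (by simp only [Model.mul_zero, add_zero])
    (fun n hn => by rw [Model.add_succ, Model.mul_succ, hn, Model.mul_succ, add_assoc]) n

protected theorem mul_assoc (a b n : N) : a * b * n = a * (b * n) :=
  arith_induction (.eq (.var 2 * .var 3 * .var 1) (.var 2 * (.var 3 * .var 1)))
    (push a fun _ => b) (fun _ _ _ => Iff.rfl) (by simp only [Model.mul_zero])
    (fun n hn => by rw [Model.mul_succ, hn, Model.mul_succ, Model.mul_add]) n

protected theorem mul_one (a : N) : a * 1 = a := by
  rw [← zero_add (1 : N), Model.mul_succ, Model.mul_zero, zero_add]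

instance instCommSemiring : CommSemiring N where
  zero_mul := Model.zero_mul
  mul_zero := Model.mul_zero
  mul_assoc := Model.mul_assoc
  one_mul a := by rw [Model.mul_comm, Model.mul_one]
  mul_one := Model.mul_one
  left_distrib := Model.mul_add
  right_distrib a b c := by
    rw [Model.mul_comm, Model.mul_add, Model.mul_comm c a, Model.mul_comm c b]
  mul_comm := Model.mul_comm
  nsmul := nsmulRec

theorem eq_zero_or_succ (n : N) : n = 0 ∨ ∃ m, n = m + 1 := by
  obtain ⟨y, h⟩ := arith_exists_induction (P := fun n y : N => n = 0 ∨ n = y + 1)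
    (.or (.eq (.var 1) 0) (.eq (.var 1) (.var 0 + 1))) (fun _ => 0)
    (fun _ _ _ => BddFormula.holds_or) ⟨0, .inl rfl⟩ (fun n _ => ⟨n, .inr rfl⟩) n
  exact h.imp_right fun h => ⟨y, h⟩

protected theorem add_left_cancel (a b c : N) : a + b = a + c → b = c :=
  arith_induction
    (.imp (.eq (.var 1 + .var 2) (.var 1 + .var 3)) (.eq (.var 2) (.var 3)))
    (push b fun _ => c) (fun _ _ _ => BddFormula.holds_imp)
    (fun h => by rwa [zero_add, zero_add] at h)
    (fun n hn h => hn (models.succ_inj _ _ (by rwa [Model.succ_add, Model.succ_add] at h))) a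

protected theorem lt_succ {m n : N} : m < n + 1 ↔ m < n ∨ m = n := models.lt_succ m n

protected theorem lt_add (a z : N) : a < a + (z + 1) :=
  arith_induction (.lt (.var 2) (.var 2 + (.var 1 + 1)))
    (fun _ => a) (fun _ _ _ => Iff.rfl)
    (by rw [zero_add, Model.lt_succ]; exact .inr rfl)
    (fun n hn => by rw [Model.add_succ, Model.lt_succ]; exact .inl hn) z

protected theorem lt_iff {a b : N} : a < b ↔ ∃ z, b = a + (z + 1) := by
  refine ⟨fun hab => ?_, fun ⟨z, hz⟩ => hz ▸ Model.lt_add a z⟩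
  obtain ⟨y, hy⟩ := arith_exists_induction (P := fun n y : N => a < n → n = a + (y + 1))
    (.imp (.lt (.var 2) (.var 1)) (.eq (.var 1) (.var 2 + (.var 0 + 1)))) (fun _ => a)
    (fun _ _ _ => BddFormula.holds_imp) ⟨0, fun h => (models.not_lt_zero a h).elim⟩
    (fun n ⟨y, hy⟩ => by
      by_cases han : a < n
      · exact ⟨y + 1, fun _ => by rw [Model.add_succ, ← hy han]⟩
      · exact ⟨0, fun h => by rw [(Model.lt_succ.1 h).resolve_left han, zero_add]⟩) b
  exact ⟨y, hy hab⟩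

protected theorem lt_trichotomy (a b : N) : a < b ∨ a = b ∨ b < a := by
  refine arith_induction
    (.or (.lt (.var 2) (.var 1)) (.or (.eq (.var 2) (.var 1)) (.lt (.var 1) (.var 2))))
    (fun _ => a) (fun _ _ _ => BddFormula.holds_or.trans (or_congr_right BddFormula.holds_or))
    ?_ (fun n hn => ?_) b
  · rcases eq_zero_or_succ a with ha | ⟨m, rfl⟩
    · exact .inr (.inl ha)
    · exact .inr (.inr (Model.lt_iff.2 ⟨m, (zero_add _).symm⟩))
  · rcases hn with h | h | h
    · exact .inl (Model.lt_succ.2 (.inl h))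
    · exact .inl (Model.lt_succ.2 (.inr h))
    · obtain ⟨z, rfl⟩ := Model.lt_iff.1 h
      rcases eq_zero_or_succ z with rfl | ⟨z, rfl⟩
      · exact .inr (.inl (by rw [zero_add]))
      · exact .inr (.inr (Model.lt_iff.2 ⟨z, by ac_rfl⟩))

protected theorem lt_irrefl (a : N) : ¬ a < a := by
  intro h
  obtain ⟨z, hz⟩ := Model.lt_iff.1 h
  exact models.succ_ne_zero z (Model.add_left_cancel a _ _ (by rw [← hz, add_zero]))

protected theorem lt_trans {a b c : N} (hab : a < b) (hbc : b < c) : a < c := by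
  obtain ⟨y, rfl⟩ := Model.lt_iff.1 hab
  obtain ⟨z, rfl⟩ := Model.lt_iff.1 hbc
  exact Model.lt_iff.2 ⟨y + 1 + z, by ac_rfl⟩

noncomputable instance instLinearOrder : LinearOrder N where
  le a b := a < b ∨ a = b
  lt a b := a < b
  le_refl a := .inr rfl
  le_trans a b c := by
    rintro (h | rfl) (h' | rfl)
    exacts [.inl (Model.lt_trans h h'), .inl h, .inl h', .inr rfl]
  le_antisymm a b := by
    rintro (h | rfl) (h' | h')
    exacts [(Model.lt_irrefl _ (Model.lt_trans h h')).elim, h'.symm, rfl, rfl]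
  le_total a b := by
    rcases Model.lt_trichotomy a b with h | h | h
    exacts [.inl (.inl h), .inl (.inr h), .inr (.inl h)]
  lt_iff_le_not_ge a b := by
    refine ⟨fun h => ⟨.inl h, ?_⟩, ?_⟩
    · rintro (h' | rfl)
      exacts [Model.lt_irrefl _ (Model.lt_trans h h'), Model.lt_irrefl _ h]
    · rintro ⟨h | rfl, h'⟩
      exacts [h, (h' (.inr rfl)).elim]
  toDecidableLE := Classical.decRel _

protected theorem le_iff {a b : N} : a ≤ b ↔ ∃ z, b = a + z := by
  constructor
  · rintro (h | rfl)
    · obtain ⟨z, hz⟩ := Model.lt_iff.1 h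
      exact ⟨_, hz⟩
    · exact ⟨0, (add_zero _).symm⟩
  · rintro ⟨z, rfl⟩
    rcases eq_zero_or_succ z with rfl | ⟨z, rfl⟩
    · exact .inr (add_zero _).symm
    · exact .inl (Model.lt_add a z)

instance instCanonicallyOrderedAdd : CanonicallyOrderedAdd N where
  exists_add_of_le h := Model.le_iff.1 h
  le_add_self _ b := Model.le_iff.2 ⟨b, add_comm _ _⟩
  le_self_add _ b := Model.le_iff.2 ⟨b, rfl⟩

protected theorem mul_lt_mul_left {a b c : N} (ha : 0 < a) (hbc : b < c) : a * b < a * c := by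
  obtain ⟨z, rfl⟩ := Model.lt_iff.1 hbc
  obtain ⟨y, rfl⟩ := Model.lt_iff.1 ha
  exact Model.lt_iff.2 ⟨y * z + y + z, by ring⟩

instance instIsStrictOrderedRing : IsStrictOrderedRing N where
  add_le_add_left a b h c := by
    obtain ⟨z, rfl⟩ := Model.le_iff.1 h
    exact Model.le_iff.2 ⟨z, by ac_rfl⟩
  le_of_add_le_add_left a b c h := by
    obtain ⟨z, hz⟩ := Model.le_iff.1 h
    exact Model.le_iff.2 ⟨z, Model.add_left_cancel a _ _ (by rw [hz, add_assoc])⟩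
  zero_le_one := Model.le_iff.2 ⟨1, (zero_add 1).symm⟩
  exists_pair_ne := ⟨0, 1, fun h => models.succ_ne_zero (0 : N) (by rw [← h, add_zero])⟩
  mul_lt_mul_of_pos_left _ ha _ _ h := Model.mul_lt_mul_left ha h
  mul_lt_mul_of_pos_right a ha b c h := by
    simpa only [mul_comm _ a] using Model.mul_lt_mul_left ha h

noncomputable instance instSuccOrder : SuccOrder N :=
  .ofSuccLeIff (· + 1) fun {a b} => by
    rw [← not_lt, Model.lt_succ, ← le_iff_lt_or_eq, not_le]

noncomputable instance instSuccAddOrder : SuccAddOrder N := ⟨fun _ => rfl⟩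

end Model

open Model (sets models)

section Pairs

variable {N : Type u} [Model N]

theorem exists_eq_add_one {n : N} (h : n ≠ 0) : ∃ m, n = m + 1 :=
  (Model.eq_zero_or_succ n).resolve_left h

/-! ### Pairs -/

theorem left_le_pair (x y : N) : x ≤ pair x y := le_add_self

theorem right_le_pair (x y : N) : y ≤ pair x y := by
  rcases eq_or_ne y 0 with rfl | hy
  · exact zero_le
  · calc y ≤ y * y := le_mul_of_one_le_left' (Order.one_le_iff_pos.2 hy.pos)
      _ ≤ (x + y) * (x + y) := by gcongr <;> exact le_add_self
      _ ≤ pair x y := le_self_add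

theorem left_lt_pair_add_one (x y : N) : x < pair x y + 1 :=
  Order.lt_add_one_iff.2 (left_le_pair x y)

theorem right_lt_pair_add_one (x y : N) : y < pair x y + 1 :=
  Order.lt_add_one_iff.2 (right_le_pair x y)

theorem pair_lt_pair_of_add_lt {x y x' y' : N} (h : x + y < x' + y') :
    pair x y < pair x' y' :=
  have h : x + y + 1 ≤ x' + y' := Order.add_one_le_iff.2 h
  calc pair x y ≤ (x + y) * (x + y) + (x + y) := add_le_add_right le_self_add _
    _ = (x + y + 1) * (x + y) := by ring
    _ < (x + y + 1) * (x + y + 1) := mul_lt_mul_of_pos_left (lt_add_one _) (by positivity)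
    _ ≤ (x' + y') * (x' + y') := mul_le_mul' h h
    _ ≤ pair x' y' := le_self_add

theorem pair_inj {x y x' y' : N} : pair x y = pair x' y' ↔ x = x' ∧ y = y' := by
  refine ⟨fun h => ?_, fun ⟨h, h'⟩ => h ▸ h' ▸ rfl⟩
  have hs : x + y = x' + y' := by
    rcases lt_trichotomy (x + y) (x' + y') with h' | h' | h'
    exacts [absurd h (pair_lt_pair_of_add_lt h').ne, h',
      absurd h.symm (pair_lt_pair_of_add_lt h').ne]
  unfold pair at h
  rw [hs] at h
  obtain rfl := add_left_cancel h
  exact ⟨rfl, add_left_cancel hs⟩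

end Pairs

/-! ### Comprehension -/

section Formulas

variable {M : Type u}

@[simp] theorem push_zero (x : M) (e : ℕ → M) : push x e 0 = x := rfl

@[simp] theorem push_succ (x : M) (e : ℕ → M) (i : ℕ) : push x e (i + 1) = e i := rfl

theorem push_mem {A : Set M} {x : M} {e : ℕ → M} (hx : x ∈ A) (he : ∀ i, e i ∈ A) :
    ∀ i, push x e i ∈ A
  | 0 => hx
  | i + 1 => he i

/-- The term for the code of a pair. -/
def NumTerm.pair (s t : NumTerm) : NumTerm := (s + t) * (s + t) + s

attribute [simp] BddFormula.Holds BddFormula.holds_or BddFormula.holds_imp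

section NumStr

variable [NumStr M] (s t : NumTerm) (e : ℕ → M)

@[simp] theorem val_var (i : ℕ) : (NumTerm.var i).val e = e i := rfl
@[simp] theorem val_zero : (0 : NumTerm).val e = 0 := rfl
@[simp] theorem val_one : (1 : NumTerm).val e = 1 := rfl
@[simp] theorem val_add : (s + t).val e = s.val e + t.val e := rfl
@[simp] theorem val_mul : (s * t).val e = s.val e * t.val e := rfl
@[simp] theorem val_pair : (s.pair t).val e = pair (s.val e) (t.val e) := rfl

end NumStr

/-- The formula `∃ x y, vᵢ = ⟨x, y⟩ ∧ φ`, in which `y` and `x` have the indices `0` and `1` in `φ`.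
The quantifiers can be bounded because components are at most as large as the code of the pair. -/
def BddFormula.exPair (i : ℕ) (φ : BddFormula) : BddFormula :=
  .neg (.ball (.var i + 1) (.ball (.var (i + 1) + 1)
    (.imp (.eq (.var (i + 2)) (.pair (.var 1) (.var 0))) (.neg φ))))

@[simp] theorem BddFormula.holds_exPair [Model M] {E : ℕ → Set M} {i : ℕ} {φ : BddFormula}
    {e : ℕ → M} : (φ.exPair i).Holds E e ↔
      ∃ x y, e i = SOA.pair x y ∧ φ.Holds E (push y (push x e)) := by
  simp only [exPair, Holds, holds_imp, val_add, val_var, val_one, val_pair, push_succ, push_zero]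
  push Not
  constructor
  · rintro ⟨x, -, y, -, h⟩
    exact ⟨x, y, h⟩
  · rintro ⟨x, y, h, hφ⟩
    exact ⟨x, h ▸ left_lt_pair_add_one x y, y, h ▸ right_lt_pair_add_one x y, h, hφ⟩

end Formulas

section Comprehension

variable {N : Type u} [Model N] {A B C : Set N}

theorem delta_comprehension (hA : A ∈ sets (N := N)) (hB : B ∈ sets (N := N))
    (hC : C ∈ sets (N := N)) (c : N) (φ ψ : BddFormula) {X : Set N}
    (hφ : ∀ n, (∃ y, φ.Holds (push A (push B fun _ => C)) (push y (push n fun _ => c))) ↔ n ∈ X)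
    (hψ : ∀ n, (∀ y, ψ.Holds (push A (push B fun _ => C)) (push y (push n fun _ => c))) ↔ n ∈ X) :
    X ∈ sets (N := N) := by
  obtain ⟨Y, hY, hYφ⟩ := models.deltaOne_comprehension φ ψ _ (fun _ => c)
    (push_mem hA (push_mem hB fun _ => hC)) fun n => (hφ n).trans (hψ n).symm
  rwa [← Set.ext fun n => (hYφ n).trans (hφ n)]

theorem bdd_comprehension (hA : A ∈ sets (N := N)) (hB : B ∈ sets (N := N))
    (hC : C ∈ sets (N := N)) (c : N) (φ : BddFormula) {X : Set N}
    (h : ∀ n y, φ.Holds (push A (push B fun _ => C)) (push y (push n fun _ => c)) ↔ n ∈ X) :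
    X ∈ sets (N := N) :=
  delta_comprehension hA hB hC c φ φ (fun n => by simp only [h, exists_const])
    fun n => by simp only [h, forall_const]

theorem univ_mem_sets : Set.univ ∈ sets (N := N) := by
  obtain ⟨A, hA⟩ := (models (N := N)).nonempty
  exact bdd_comprehension hA hA hA 0 (.eq 0 0) (by simp)

end Comprehension

/-! ### Definable functions -/

/-- Types whose elements are coded by the elements of a set of the model. -/
class Codable (N : Type u) [Model N] (α : Type v) where
  toNum : α → N
  toNum_injective : Function.Injective toNum
  range_toNum_mem : Set.range toNum ∈ sets (N := N)

section Codable

variable {N : Type u} [Model N] {α : Type v} {β : Type w}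

/-- The code of an element of a codable type. -/
def enc (N : Type u) [Model N] {α : Type v} [Codable N α] (a : α) : N := Codable.toNum a

theorem enc_injective [Codable N α] : Function.Injective (enc N (α := α)) :=
  Codable.toNum_injective

@[simp] theorem enc_inj [Codable N α] {a b : α} : enc N a = enc N b ↔ a = b :=
  enc_injective.eq_iff

theorem range_enc_mem (α : Type v) [Codable N α] : Set.range (enc N (α := α)) ∈ sets (N := N) :=
  Codable.range_toNum_mem

instance : Codable N N where
  toNum := id
  toNum_injective := Function.injective_id
  range_toNum_mem := by simpa only [Set.range_id] using univ_mem_sets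

@[simp] theorem enc_num (x : N) : enc N x = x := rfl

open Classical in
noncomputable instance : Codable N Prop where
  toNum p := if p then 1 else 0
  toNum_injective p q h := by by_cases hp : p <;> by_cases hq : q <;> simp_all
  range_toNum_mem := by
    refine bdd_comprehension univ_mem_sets univ_mem_sets univ_mem_sets 0
      (.or (.eq (.var 1) 1) (.eq (.var 1) 0)) fun n _ => BddFormula.holds_or.trans ⟨?_, ?_⟩
    · rintro (h | h)
      exacts [⟨True, (if_pos trivial).trans h.symm⟩, ⟨False, (if_neg not_false).trans h.symm⟩]
    · rintro ⟨p, rfl⟩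
      exact ite_eq_or_eq p 1 0

@[simp] theorem enc_true : enc N True = 1 := if_pos trivial

@[simp] theorem enc_false : enc N False = 0 := if_neg not_false

theorem eq_enc_prop {p : Prop} {z : N} : z = enc N p ↔ p ∧ z = 1 ∨ ¬ p ∧ z = 0 := by
  by_cases hp : p <;> simp [hp]

theorem one_eq_enc {p : Prop} : 1 = enc N p ↔ p := by
  simp [eq_enc_prop]

instance [Codable N α] [Codable N β] : Codable N (α × β) where
  toNum p := pair (enc N p.1) (enc N p.2)
  toNum_injective p q h :=
    Prod.ext (enc_injective (pair_inj.1 h).1) (enc_injective (pair_inj.1 h).2)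
  range_toNum_mem :=
    bdd_comprehension (range_enc_mem α) (range_enc_mem β) univ_mem_sets 0
      (.exPair 1 (.and (.mem (.var 1) 0) (.mem (.var 0) 1))) fun n _ => by
      simp [eq_comm (a := n)]

@[simp] theorem enc_prod [Codable N α] [Codable N β] (p : α × β) :
    enc N p = pair (enc N p.1) (enc N p.2) := rfl

end Codable

section Definable

variable {N : Type u} [Model N] {α : Type v} {β : Type w} [Codable N α] [Codable N β]

/-- The graph of a function between codable types, as a set of codes. -/
def graph (N : Type u) [Model N] {α : Type v} {β : Type w} [Codable N α] [Codable N β]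
    (f : α → β) : Set N :=
  {z | ∃ a, z = pair (enc N a) (enc N (f a))}

/-- The codes of the elements at which a predicate on a codable type holds. -/
def codes (N : Type u) [Model N] {α : Type v} [Codable N α] (P : α → Prop) : Set N :=
  {z | ∃ a, P a ∧ z = enc N a}

theorem mem_graph {f : α → β} {z : N} : z ∈ graph N f ↔ ∃ a, z = pair (enc N a) (enc N (f a)) :=
  Iff.rfl

theorem mem_codes {P : α → Prop} {z : N} : z ∈ codes N P ↔ ∃ a, P a ∧ z = enc N a := Iff.rfl

@[simp] theorem pair_mem_graph {f : α → β} {a : α} {z : N} :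
    pair (enc N a) z ∈ graph N f ↔ z = enc N (f a) := by
  simp [graph, pair_inj]

@[simp] theorem enc_mem_codes {P : α → Prop} {a : α} : enc N a ∈ codes N P ↔ P a := by
  simp [codes]

@[simp] theorem enc_pair_mem_codes {P : α × β → Prop} {a : α} {b : β} :
    pair (enc N a) (enc N b) ∈ codes N P ↔ P (a, b) :=
  enc_mem_codes (a := (a, b))

@[simp] theorem pair_num_mem_codes {P : α × N → Prop} {a : α} {z : N} :
    pair (enc N a) z ∈ codes N P ↔ P (a, z) :=
  enc_pair_mem_codes

@[simp] theorem codes_num (P : N → Prop) : codes N P = {n | P n} := by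
  simp [codes]

/-- A function between codable types is definable (computable) if the model contains its graph.
Predicates are functions to `Prop`. -/
@[fun_prop]
def Definable (N : Type u) [Model N] {α : Type v} {β : Type w} [Codable N α] [Codable N β]
    (f : α → β) : Prop :=
  graph N f ∈ sets (N := N)

end Definable

namespace Definable

variable {N : Type u} [Model N] {α : Type v} {β : Type w} {γ δ ε : Type*}
  [Codable N α] [Codable N β] [Codable N γ] [Codable N δ] [Codable N ε]

theorem iff_codes_mem {P : α → Prop} : Definable N P ↔ codes N P ∈ sets (N := N) := by
  constructor <;> intro h
  · refine bdd_comprehension h univ_mem_sets univ_mem_sets 0 (.mem (.pair (.var 1) 1) 0)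
      fun n _ => ?_
    simp [mem_graph, mem_codes, pair_inj, one_eq_enc, and_comm]
  · refine bdd_comprehension h (range_enc_mem α) univ_mem_sets 0
      (.exPair 1 (.and (.mem (.var 1) 1) (.or (.and (.mem (.var 1) 0) (.eq (.var 0) 1))
        (.and (.neg (.mem (.var 1) 0)) (.eq (.var 0) 0))))) fun n _ => ?_
    suffices (∃ z a, n = pair (enc N a) z ∧ (P a ∧ z = 1 ∨ ¬ P a ∧ z = 0)) ↔ n ∈ graph N P by
      simpa
    simp only [← eq_enc_prop, exists_comm (α := N), exists_eq_right, mem_graph]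

@[fun_prop]
theorem id : Definable N fun a : α => a :=
  bdd_comprehension (range_enc_mem α) univ_mem_sets univ_mem_sets 0
    (.exPair 1 (.and (.mem (.var 1) 0) (.eq (.var 1) (.var 0)))) fun n _ => by
    simp [mem_graph]

@[fun_prop]
theorem const (b : β) : Definable N fun _ : α => b :=
  bdd_comprehension (range_enc_mem α) univ_mem_sets univ_mem_sets (enc N b)
    (.exPair 1 (.and (.mem (.var 1) 0) (.eq (.var 0) (.var 4)))) fun n _ => by
    simp [mem_graph]

@[fun_prop]
theorem comp {g : β → γ} {f : α → β} (hg : Definable N g) (hf : Definable N f) :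
    Definable N fun a => g (f a) := by
  refine delta_comprehension (range_enc_mem α) hf hg 0
    (.exPair 1 (.and (.mem (.var 1) 0) (.and (.mem (.pair (.var 1) (.var 2)) 1)
      (.mem (.pair (.var 2) (.var 0)) 2))))
    (.exPair 1 (.and (.mem (.var 1) 0) (.imp (.mem (.pair (.var 1) (.var 2)) 1)
      (.mem (.pair (.var 2) (.var 0)) 2))))
    (fun n => Iff.trans (by simp) mem_graph.symm) fun n => ?_
  suffices (∀ y, ∃ z a, n = pair (enc N a) z ∧ (y = enc N (f a) → pair y z ∈ graph N g)) ↔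
    n ∈ graph N fun a => g (f a) by simpa
  rw [mem_graph]
  constructor
  · intro h
    obtain ⟨_, a, rfl, -⟩ := h 0
    obtain ⟨z, a', ha, hz⟩ := h (enc N (f a))
    obtain ⟨haa', rfl⟩ := pair_inj.1 ha
    obtain rfl := enc_injective haa'
    exact ⟨a, by rw [pair_mem_graph.1 (hz rfl)]⟩
  · rintro ⟨a, rfl⟩ y
    exact ⟨_, a, rfl, fun h => h ▸ pair_mem_graph.2 rfl⟩

@[fun_prop]
theorem prodMk {f : α → β} {g : α → γ} (hf : Definable N f) (hg : Definable N g) :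
    Definable N fun a => (f a, g a) :=
  bdd_comprehension (range_enc_mem α) hf hg 0
    (.exPair 1 (.exPair 0 (.and (.mem (.var 3) 0)
      (.and (.mem (.pair (.var 3) (.var 1)) 1) (.mem (.pair (.var 3) (.var 0)) 2))))) fun n _ =>
    Iff.trans (by simp) mem_graph.symm

theorem prodFst : Definable N fun p : α × β => p.1 :=
  bdd_comprehension (range_enc_mem (α × β)) univ_mem_sets univ_mem_sets 0
    (.exPair 1 (.and (.mem (.var 1) 0) (.exPair 1 (.eq (.var 1) (.var 2))))) fun n _ => by
    simp [mem_graph, pair_inj]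

theorem prodSnd : Definable N fun p : α × β => p.2 :=
  bdd_comprehension (range_enc_mem (α × β)) univ_mem_sets univ_mem_sets 0
    (.exPair 1 (.and (.mem (.var 1) 0) (.exPair 1 (.eq (.var 0) (.var 2))))) fun n _ => by
    simp [mem_graph, pair_inj]

@[fun_prop]
theorem fst {f : α → β × γ} (hf : Definable N f) : Definable N fun a => (f a).1 :=
  prodFst.comp hf

@[fun_prop]
theorem snd {f : α → β × γ} (hf : Definable N f) : Definable N fun a => (f a).2 :=
  prodSnd.comp hf

theorem comp₂ {F : β → γ → δ} {f : α → β} {g : α → γ}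
    (hF : Definable N fun p : β × γ => F p.1 p.2) (hf : Definable N f) (hg : Definable N g) :
    Definable N fun a => F (f a) (g a) :=
  comp (g := fun p : β × γ => F p.1 p.2) hF (hf.prodMk hg)

theorem comp₃ {F : β → γ → δ → ε} {f : α → β} {g : α → γ} {h : α → δ}
    (hF : Definable N fun p : (β × γ) × δ => F p.1.1 p.1.2 p.2)
    (hf : Definable N f) (hg : Definable N g) (hh : Definable N h) :
    Definable N fun a => F (f a) (g a) (h a) :=
  comp (g := fun p : (β × γ) × δ => F p.1.1 p.1.2 p.2) hF ((hf.prodMk hg).prodMk hh)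

theorem of_term {t : NumTerm} {F : N → N → N}
    (h : ∀ (x y : N) (e : ℕ → N), t.val (push y (push x e)) = F x y) :
    Definable N fun p : N × N => F p.1 p.2 :=
  bdd_comprehension univ_mem_sets univ_mem_sets univ_mem_sets 0
    (.exPair 1 (.exPair 1 (.eq (.var 2) t))) fun n _ => by
    simp [mem_graph, h]

@[fun_prop]
theorem add {f g : α → N} (hf : Definable N f) (hg : Definable N g) :
    Definable N fun a => f a + g a :=
  (of_term (t := .var 1 + .var 0) (F := (· + ·)) fun _ _ _ => rfl).comp (hf.prodMk hg)

@[fun_prop]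
theorem mul {f g : α → N} (hf : Definable N f) (hg : Definable N g) :
    Definable N fun a => f a * g a :=
  (of_term (t := .var 1 * .var 0) (F := (· * ·)) fun _ _ _ => rfl).comp (hf.prodMk hg)

@[fun_prop]
theorem numPair {f g : α → N} (hf : Definable N f) (hg : Definable N g) :
    Definable N fun a => pair (f a) (g a) := by
  unfold pair; fun_prop

@[fun_prop]
theorem and {P Q : α → Prop} (hP : Definable N P) (hQ : Definable N Q) :
    Definable N fun a => P a ∧ Q a :=
  iff_codes_mem.2 <| bdd_comprehension (iff_codes_mem.1 hP) (iff_codes_mem.1 hQ) univ_mem_sets 0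
    (.and (.mem (.var 1) 0) (.mem (.var 1) 1)) fun n _ => by
    suffices (n ∈ codes N P ∧ n ∈ codes N Q) ↔ n ∈ codes N fun a => P a ∧ Q a by simpa
    constructor
    · rintro ⟨⟨a, hP, rfl⟩, hQ⟩
      exact ⟨a, ⟨hP, enc_mem_codes.1 hQ⟩, rfl⟩
    · rintro ⟨a, ⟨hP, hQ⟩, rfl⟩
      exact ⟨⟨a, hP, rfl⟩, a, hQ, rfl⟩

@[fun_prop]
theorem not {P : α → Prop} (hP : Definable N P) : Definable N fun a => ¬ P a :=
  iff_codes_mem.2 <| bdd_comprehension (range_enc_mem α) (iff_codes_mem.1 hP) univ_mem_sets 0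
    (.and (.mem (.var 1) 0) (.neg (.mem (.var 1) 1))) fun n _ => by
    suffices ((∃ a, enc N a = n) ∧ n ∉ codes N P) ↔ n ∈ codes N fun a => ¬ P a by simpa
    constructor
    · rintro ⟨⟨a, rfl⟩, ha⟩
      exact ⟨a, fun h => ha (enc_mem_codes.2 h), rfl⟩
    · rintro ⟨a, ha, rfl⟩
      exact ⟨⟨a, rfl⟩, fun h => ha (enc_mem_codes.1 h)⟩

@[fun_prop]
theorem or {P Q : α → Prop} (hP : Definable N P) (hQ : Definable N Q) :
    Definable N fun a => P a ∨ Q a := by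
  simpa only [not_and_or, not_not] using (hP.not.and hQ.not).not

theorem imp {P Q : α → Prop} (hP : Definable N P) (hQ : Definable N Q) :
    Definable N fun a => P a → Q a := by
  simpa only [imp_iff_not_or] using hP.not.or hQ

@[fun_prop]
theorem iff {P Q : α → Prop} (hP : Definable N P) (hQ : Definable N Q) :
    Definable N fun a => P a ↔ Q a := by
  simpa only [iff_iff_implies_and_implies] using (hP.imp hQ).and (hQ.imp hP)

@[fun_prop]
theorem eq {f g : α → β} (hf : Definable N f) (hg : Definable N g) :
    Definable N fun a => f a = g a := by
  have diagonal : Definable N fun p : β × β => p.1 = p.2 := by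
    have : codes N (fun p : β × β => p.1 = p.2) = graph N fun b : β => b := by
      ext; simp [mem_codes, mem_graph]
    rw [iff_codes_mem, this]
    exact id
  exact diagonal.comp (hf.prodMk hg)

@[fun_prop]
theorem lt {f g : α → N} (hf : Definable N f) (hg : Definable N g) :
    Definable N fun a => f a < g a :=
  have num_lt : Definable N fun p : N × N => p.1 < p.2 :=
    iff_codes_mem.2 <| bdd_comprehension univ_mem_sets univ_mem_sets univ_mem_sets 0
      (.exPair 1 (.lt (.var 1) (.var 0))) fun n _ => by
      simp [mem_codes, and_comm]
  num_lt.comp (hf.prodMk hg)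

@[fun_prop]
theorem le {f g : α → N} (hf : Definable N f) (hg : Definable N g) :
    Definable N fun a => f a ≤ g a := by
  simpa only [not_lt] using (hg.lt hf).not

theorem mem_sets {P : N → Prop} (hP : Definable N P) : {x | P x} ∈ sets (N := N) := by
  simpa only [iff_codes_mem, codes_num] using hP

@[fun_prop]
theorem mem {A : Set N} (hA : A ∈ sets (N := N)) {f : α → N} (hf : Definable N f) :
    Definable N fun a => f a ∈ A := by
  have : Definable N fun x => x ∈ A := by rwa [iff_codes_mem, codes_num]
  exact this.comp hf

theorem ball {t : α → N} {P : α → N → Prop} (ht : Definable N t)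
    (hP : Definable N fun p : α × N => P p.1 p.2) : Definable N fun a => ∀ x < t a, P a x := by
  have : Definable N fun p : α × N => ∀ x < p.2, P p.1 x :=
    iff_codes_mem.2 <| bdd_comprehension (range_enc_mem α) (iff_codes_mem.1 hP) univ_mem_sets 0
      (.exPair 1 (.and (.mem (.var 1) 0) (.ball (.var 0) (.mem (.pair (.var 2) (.var 0)) 1))))
      fun n _ => by
      rw [mem_codes, Prod.exists, exists_comm]
      simp [and_comm]
  exact this.comp₂ (F := fun a n => ∀ x < n, P a x) id ht

theorem bex {t : α → N} {P : α → N → Prop} (ht : Definable N t)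
    (hP : Definable N fun p : α × N => P p.1 p.2) : Definable N fun a => ∃ x < t a, P a x := by
  simpa only [not_forall, not_not, exists_prop] using (ball (P := fun a x => ¬ P a x) ht hP.not).not

theorem of_graph {f : α → β} (h : Definable N fun p : α × β => p.2 = f p.1) : Definable N f := by
  have : graph N f = codes N fun p : α × β => p.2 = f p.1 := by
    ext; simp [mem_codes, mem_graph]
  unfold Definable
  rw [this, ← iff_codes_mem]
  exact h

theorem section_right {P : α → N → β} (hP : Definable N fun p : α × N => P p.1 p.2) (a : α) :
    Definable N (P a) :=
  hP.comp₂ (const a) id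

end Definable

section Induction

variable {N : Type u} [Model N] {α : Type v} [Codable N α]

/-! ### Induction and minimization -/

theorem definable_induction {P : N → Prop} (hP : Definable N P) (zero : P 0)
    (succ : ∀ n, P n → P (n + 1)) (n : N) : P n :=
  have ⟨_, hn⟩ := Model.exists_induction (P := fun n _ => P n) (.mem (.var 1) 0) (fun _ => 0)
    (fun _ => {n | P n}) (fun _ => hP.mem_sets) (fun _ _ => Iff.rfl) ⟨0, zero⟩
    (fun n ⟨_, hn⟩ => ⟨0, succ n hn⟩) n
  hn

theorem sigma_induction {P : N → N → Prop} (hP : Definable N fun p : N × N => P p.1 p.2)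
    (zero : ∃ y, P 0 y) (succ : ∀ n, (∃ y, P n y) → ∃ y, P (n + 1) y) (n : N) : ∃ y, P n y :=
  Model.exists_induction (.mem (.pair (.var 1) (.var 0)) 0) (fun _ => 0)
    (fun _ => codes N fun p : N × N => P p.1 p.2) (fun _ => Definable.iff_codes_mem.1 hP)
    (fun n y => enc_mem_codes (a := (n, y))) zero succ n

theorem exists_least {P : N → Prop} (hP : Definable N P) (h : ∃ n, P n) :
    ∃ m, P m ∧ ∀ k < m, ¬ P k := by
  by_contra! no_least
  have none_below : ∀ n : N, ∀ k < n, ¬ P k := by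
    refine definable_induction (.ball (by fun_prop) (by fun_prop))
      (fun k hk => (not_lt_zero hk).elim) fun n ih k hk hPk => ?_
    obtain ⟨j, hj, hPj⟩ := no_least k hPk
    exact ih j (hj.trans_le (Order.lt_add_one_iff.1 hk)) hPj
  obtain ⟨n, hn⟩ := h
  exact none_below (n + 1) n (lt_add_one n) hn

theorem exists_definable_least {P : α → N → Prop} (hP : Definable N fun p : α × N => P p.1 p.2)
    (h : ∀ a, ∃ y, P a y) :
    ∃ f : α → N, Definable N f ∧ (∀ a, P a (f a)) ∧ ∀ a, ∀ y < f a, ¬ P a y := by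
  choose f hf hmin using fun a => exists_least (hP.section_right a) (h a)
  have graph_iff : ∀ p : α × N, p.2 = f p.1 ↔ P p.1 p.2 ∧ ∀ y < p.2, ¬ P p.1 y := by
    rintro ⟨a, y⟩
    refine ⟨fun (h : y = f a) => h ▸ ⟨hf a, hmin a⟩, fun ⟨hy, hymin⟩ => ?_⟩
    exact le_antisymm (not_lt.1 fun h => hymin _ h (hf a)) (not_lt.1 fun h => hmin a _ h hy)
  refine ⟨f, .of_graph ?_, hf, hmin⟩
  simp only [graph_iff]
  exact hP.and (.ball (by fun_prop) (hP.comp₂ (by fun_prop) (by fun_prop)).not)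

theorem exists_definable {P : α → N → Prop} (hP : Definable N fun p : α × N => P p.1 p.2)
    (h : ∀ a, ∃ y, P a y) : ∃ f : α → N, Definable N f ∧ ∀ a, P a (f a) :=
  (exists_definable_least hP h).imp fun _ h => ⟨h.1, h.2.1⟩

theorem exists_eq_pair_iff {P : N → N → Prop} {t : N} :
    (∃ x y, t = pair x y ∧ P x y) ↔ ∃ x < t + 1, ∃ y < t + 1, t = pair x y ∧ P x y := by
  constructor
  · rintro ⟨x, y, rfl, h⟩
    exact ⟨x, left_lt_pair_add_one x y, y, right_lt_pair_add_one x y, rfl, h⟩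
  · rintro ⟨x, -, y, -, h⟩
    exact ⟨x, y, h⟩

theorem Definable.exPair {t : α → N} {P : α → N → N → Prop} (ht : Definable N t)
    (hP : Definable N fun p : (α × N) × N => P p.1.1 p.1.2 p.2) :
    Definable N fun a => ∃ x y, t a = pair x y ∧ P a x y := by
  simp only [exists_eq_pair_iff]
  exact .bex (by fun_prop) (.bex (by fun_prop) (.and (by fun_prop) hP))

theorem exists_definable_pair {P : α → N → N → Prop}
    (hP : Definable N fun p : (α × N) × N => P p.1.1 p.1.2 p.2) (h : ∀ a, ∃ y z, P a y z) :
    ∃ f g : α → N, Definable N f ∧ Definable N g ∧ ∀ a, P a (f a) (g a) := by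
  obtain ⟨k, hk, hPk⟩ := exists_definable (P := fun a w => ∃ y z, w = pair y z ∧ P a y z)
    (.exPair (by fun_prop) (hP.comp₃ (by fun_prop) (by fun_prop) (by fun_prop)))
    fun a => let ⟨y, z, h⟩ := h a; ⟨_, y, z, rfl, h⟩
  choose f g hfg hPfg using hPk
  have f_iff : ∀ p : α × N, p.2 = f p.1 ↔ ∃ y z, k p.1 = pair y z ∧ p.2 = y := fun p =>
    ⟨fun h => ⟨_, _, hfg p.1, h⟩, fun ⟨y, z, h, hy⟩ =>
      hy.trans (pair_inj.1 (h.symm.trans (hfg p.1))).1⟩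
  have g_iff : ∀ p : α × N, p.2 = g p.1 ↔ ∃ y z, k p.1 = pair y z ∧ p.2 = z := fun p =>
    ⟨fun h => ⟨_, _, hfg p.1, h⟩, fun ⟨y, z, h, hz⟩ =>
      hz.trans (pair_inj.1 (h.symm.trans (hfg p.1))).2⟩
  refine ⟨f, g, .of_graph ?_, .of_graph ?_, hPfg⟩
  · simp only [f_iff]
    exact .exPair (by fun_prop) (by fun_prop)
  · simp only [g_iff]
    exact .exPair (by fun_prop) (by fun_prop)

end Induction

section FinSet

variable {N : Type u} [Model N] {α : Type v} [Codable N α]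

/-! ### Divisibility -/

theorem dvd_iff_exists_lt {a b : N} : a ∣ b ↔ ∃ q < b + 1, b = a * q := by
  refine ⟨?_, fun ⟨q, _, h⟩ => ⟨q, h⟩⟩
  rintro ⟨q, rfl⟩
  rcases eq_or_ne a 0 with rfl | ha
  · exact ⟨0, by simp, by simp⟩
  · exact ⟨q, Order.lt_add_one_iff.2 (le_mul_of_one_le_left' (Order.one_le_iff_pos.2 ha.pos)), rfl⟩

@[fun_prop]
theorem Definable.dvd {f g : α → N} (hf : Definable N f) (hg : Definable N g) :
    Definable N fun a => f a ∣ g a := by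
  simp only [dvd_iff_exists_lt]
  exact .bex (by fun_prop) (by fun_prop)

theorem not_dvd_one {a : N} (ha : 1 < a) : ¬ a ∣ 1 := by
  rintro ⟨q, hq⟩
  have hq0 : q ≠ 0 := by rintro rfl; simp at hq
  exact ha.not_ge ((le_mul_of_one_le_right' (Order.one_le_iff_pos.2 hq0.pos)).trans hq.ge)

theorem dvd_of_dvd_add {a b c : N} (hb : a ∣ b) (h : a ∣ b + c) : a ∣ c := by
  obtain ⟨x, rfl⟩ := hb
  obtain ⟨y, hy⟩ := h
  rcases eq_or_ne a 0 with rfl | ha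
  · simp_all
  · have hxy : a * x ≤ a * y := hy ▸ le_self_add
    obtain ⟨z, rfl⟩ := Model.le_iff.1 (le_of_mul_le_mul_left hxy ha.pos)
    exact ⟨z, add_left_cancel (hy.trans (mul_add a x z))⟩

theorem dvd_of_dvd_mul_left_of_add_one {m a x : N} (h : m * a + 1 ∣ x * m) : m * a + 1 ∣ x :=
  dvd_of_dvd_add (h.mul_right a) ⟨x, by ring⟩

theorem exists_common_multiple (k : N) : ∃ m : N, 0 < m ∧ ∀ i < k, i + 1 ∣ m := by
  refine sigma_induction (P := fun k m => 0 < m ∧ ∀ i < k, i + 1 ∣ m)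
    (.and (by fun_prop) (.ball (by fun_prop) (by fun_prop)))
    ⟨1, one_pos, fun i hi => (not_lt_zero hi).elim⟩ ?_ k
  rintro k ⟨m, hm, h⟩
  refine ⟨(k + 1) * m, by positivity, fun i hi => ?_⟩
  rcases (Order.lt_add_one_iff.1 hi).lt_or_eq with hik | rfl
  · exact (h i hik).mul_left _
  · exact dvd_mul_right _ _

/-- The moduli of Gödel's β function are pairwise coprime. -/
theorem dvd_of_dvd_mul_modulus {m k i j n : N} (hm : ∀ c < k, c + 1 ∣ m) (hi : i < k) (hj : j < k)
    (hij : i ≠ j) (h : m * (i + 1) + 1 ∣ n * (m * (j + 1) + 1)) : m * (i + 1) + 1 ∣ n := by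
  obtain ⟨c, hc, hdvd⟩ : ∃ c < k, m * (i + 1) + 1 ∣ n * m * (c + 1) := by
    rcases hij.lt_or_gt with hlt | hlt <;> obtain ⟨c, rfl⟩ := Model.lt_iff.1 hlt
    · refine ⟨c, lt_of_le_of_lt (le_self_add.trans le_add_self) hj,
        dvd_of_dvd_add (dvd_mul_left (m * (i + 1) + 1) n) ?_⟩
      convert h using 1
      ring
    · refine ⟨c, lt_of_le_of_lt (le_self_add.trans le_add_self) hi, dvd_of_dvd_add h ?_⟩
      exact ⟨n, by ring⟩
  obtain ⟨q, hq⟩ := hm c hc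
  refine dvd_of_dvd_mul_left_of_add_one (dvd_of_dvd_mul_left_of_add_one ?_)
  calc m * (i + 1) + 1 ∣ n * m * (c + 1) * q := hdvd.mul_right q
    _ = n * m * m := by rw [mul_assoc, ← hq]

theorem exists_modulus_dvd_iff {P : N → Prop} (hP : Definable N P) (k : N) :
    ∃ m n : N, ∀ i < k, m * (i + 1) + 1 ∣ n ↔ P i := by
  obtain ⟨m, hm, hdvd⟩ := exists_common_multiple k
  suffices ∀ j : N, ∃ n : N, ∀ i < k, m * (i + 1) + 1 ∣ n ↔ i < j ∧ P i by
    obtain ⟨n, hn⟩ := this k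
    exact ⟨m, n, fun i hi => (hn i hi).trans (and_iff_right hi)⟩
  refine sigma_induction (.ball (by fun_prop) (by fun_prop)) ⟨1, fun i _ => ?_⟩ ?_
  · have : 1 < m * (i + 1) + 1 := lt_add_of_pos_left 1 (by positivity)
    exact iff_of_false (not_dvd_one this) fun h => not_lt_zero h.1
  rintro j ⟨n, hn⟩
  have lt_iff : ∀ i, i < j + 1 ↔ i < j ∨ i = j := fun _ =>
    Order.lt_add_one_iff.trans le_iff_lt_or_eq
  by_cases hj : j < k ∧ P j
  · refine ⟨n * (m * (j + 1) + 1), fun i hi => ?_⟩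
    rcases eq_or_ne i j with rfl | hij
    · exact iff_of_true (dvd_mul_left _ _) ⟨lt_add_one i, hj.2⟩
    · rw [lt_iff, or_iff_left hij, ← hn i hi]
      exact ⟨dvd_of_dvd_mul_modulus hdvd hi hj.1 hij, fun h => h.mul_right _⟩
  · refine ⟨n, fun i hi => (hn i hi).trans (and_congr_left fun hPi => ?_)⟩
    rw [lt_iff, or_iff_left]
    rintro rfl
    exact hj ⟨hi, hPi⟩

/-! ### Finite sets -/

theorem finMem_triple {i k m n : N} :
    FinMem i (pair k (pair m n)) ↔ i < k ∧ m * (i + 1) + 1 ∣ n := by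
  refine ⟨?_, fun h => ⟨k, m, n, rfl, h⟩⟩
  rintro ⟨k', m', n', heq, h⟩
  obtain ⟨rfl, hmn⟩ := pair_inj.1 heq
  obtain ⟨rfl, rfl⟩ := pair_inj.1 hmn
  exact h

@[fun_prop]
theorem Definable.finMem {f g : α → N} (hf : Definable N f) (hg : Definable N g) :
    Definable N fun a => FinMem (f a) (g a) := by
  have finMem_iff : ∀ i t : N, FinMem i t ↔ ∃ k r, t = pair k r ∧ ∃ m n, r = pair m n ∧
      i < k ∧ m * (i + 1) + 1 ∣ n := fun i t =>
    ⟨fun ⟨k, m, n, h⟩ => ⟨k, _, h.1, m, n, rfl, h.2⟩,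
      fun ⟨k, _, h, m, n, hr, h'⟩ => ⟨k, m, n, hr ▸ h, h'⟩⟩
  simp only [finMem_iff]
  exact .exPair (by fun_prop) (.exPair (by fun_prop) (by fun_prop))

@[fun_prop]
theorem Definable.isTriple {f : α → N} (hf : Definable N f) :
    Definable N fun a => IsTriple (f a) := by
  have isTriple_iff : ∀ t : N, IsTriple t ↔ ∃ k r, t = pair k r ∧ ∃ m n, r = pair m n ∧ True :=
    fun t => ⟨fun ⟨k, m, n, h⟩ => ⟨k, _, h, m, n, rfl, trivial⟩,
      fun ⟨k, _, h, m, n, hr, _⟩ => ⟨k, m, n, hr ▸ h⟩⟩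
  simp only [isTriple_iff]
  exact .exPair (by fun_prop) (.exPair (by fun_prop) (by fun_prop))

theorem FinMem.lt {i t : N} (h : FinMem i t) : i < t := by
  obtain ⟨k, m, n, rfl, hi, -⟩ := h
  exact hi.trans_le (left_le_pair _ _)

theorem forall_finMem_iff {s k : N} {P : N → Prop} : (∀ i : N, FinMem i s ↔ i < k ∧ P i) ↔
    ∀ i < s + k, (FinMem i s ↔ i < k ∧ P i) := by
  refine ⟨fun h i _ => h i, fun h i => ⟨fun hi => ?_, fun hi => ?_⟩⟩
  · exact (h i (hi.lt.trans_le le_self_add)).1 hi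
  · exact (h i (hi.1.trans_le le_add_self)).2 hi

theorem forall_finMem_iff_finMem {s t : N} : (∀ i : N, FinMem i s ↔ FinMem i t) ↔
    ∀ i < s + t, (FinMem i s ↔ FinMem i t) := by
  simpa only [and_iff_right_of_imp FinMem.lt] using
    forall_finMem_iff (s := s) (k := t) (P := fun i => FinMem i t)

@[fun_prop]
theorem Definable.isFinSet {f : α → N} (hf : Definable N f) :
    Definable N fun a => IsFinSet (f a) := by
  simp only [IsFinSet, forall_finMem_iff_finMem]
  exact .and (by fun_prop) (.ball (by fun_prop) (.imp (by fun_prop) (.not (.ball (by fun_prop)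
    (by fun_prop)))))

theorem IsFinSet.ext {s t : N} (hs : IsFinSet s) (ht : IsFinSet t)
    (h : ∀ i : N, FinMem i s ↔ FinMem i t) : s = t := by
  rcases lt_trichotomy s t with hlt | heq | hlt
  exacts [absurd h (ht.2 s hlt hs.1), heq, absurd (fun i => (h i).symm) (hs.2 t hlt ht.1)]

theorem exists_isFinSet {P : N → Prop} (hP : Definable N P) (k : N) :
    ∃ t : N, IsFinSet t ∧ ∀ i : N, FinMem i t ↔ i < k ∧ P i := by
  obtain ⟨m, n, hmn⟩ := exists_modulus_dvd_iff hP k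
  have represents : ∀ i, FinMem i (pair k (pair m n)) ↔ i < k ∧ P i := fun i =>
    finMem_triple.trans (and_congr_right (hmn i))
  obtain ⟨t, ⟨ht, hmem⟩, hmin⟩ := exists_least
    (P := fun t : N => IsTriple t ∧ ∀ i : N, FinMem i t ↔ i < k ∧ P i)
    (by
      simp only [forall_finMem_iff]
      exact .and (by fun_prop) (.ball (by fun_prop) (by fun_prop)))
    ⟨_, ⟨_, _, _, rfl⟩, represents⟩
  exact ⟨t, ⟨ht, fun s hs hs' h => hmin s hs ⟨hs', fun i => (h i).trans (hmem i)⟩⟩, hmem⟩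

/-- The code of the finite set of all `i < k` with property `P`. -/
noncomputable def setCode (k : N) (P : N → Prop) : N :=
  Classical.epsilon fun t => IsFinSet t ∧ ∀ i : N, FinMem i t ↔ i < k ∧ P i

theorem isFinSet_setCode {P : N → Prop} (hP : Definable N P) (k : N) : IsFinSet (setCode k P) :=
  (Classical.epsilon_spec (exists_isFinSet hP k)).1

theorem finMem_setCode {P : N → Prop} (hP : Definable N P) {k i : N} :
    FinMem i (setCode k P) ↔ i < k ∧ P i :=
  (Classical.epsilon_spec (exists_isFinSet hP k)).2 i

theorem Definable.setCode {k : α → N} {P : α → N → Prop} (hk : Definable N k)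
    (hP : Definable N fun p : α × N => P p.1 p.2) :
    Definable N fun a => setCode (k a) (P a) := by
  have graph_iff : ∀ p : α × N, p.2 = SOA.setCode (k p.1) (P p.1) ↔
      IsFinSet p.2 ∧ ∀ i : N, FinMem i p.2 ↔ i < k p.1 ∧ P p.1 i := fun ⟨a, t⟩ =>
    have ha := hP.section_right a
    ⟨fun h => h ▸ ⟨isFinSet_setCode ha _, fun _ => finMem_setCode ha⟩, fun h =>
      h.1.ext (isFinSet_setCode ha _) fun i => (h.2 i).trans (finMem_setCode ha).symm⟩
  refine .of_graph ?_
  simp only [graph_iff, forall_finMem_iff]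
  exact .and (by fun_prop) (.ball (by fun_prop) (.iff (by fun_prop) (.and (by fun_prop)
    (hP.comp₂ (by fun_prop) (by fun_prop)))))

end FinSet

section FinSeq

variable {N : Type u} [Model N] {α : Type v} {β : Type w} [Codable N α] [Codable N β]

/-! ### Finite sequences and primitive recursion -/

open Classical in
theorem Definable.ite {P : α → Prop} {f g : α → β} (hP : Definable N P) (hf : Definable N f)
    (hg : Definable N g) : Definable N fun a => if P a then f a else g a := by
  have graph_iff : ∀ p : α × β, p.2 = (if P p.1 then f p.1 else g p.1) ↔
      (P p.1 ∧ p.2 = f p.1) ∨ (¬ P p.1 ∧ p.2 = g p.1) := fun p => by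
    by_cases h : P p.1 <;> simp [h]
  refine .of_graph ?_
  simp only [graph_iff]
  fun_prop

/-- The code of the sequence of the values `F i < n` for `i < m`. -/
noncomputable def seqCode (m n : N) (F : N → N) : N :=
  setCode (pair m n) fun z => ∃ i < m, z = pair i (F i)

theorem Definable.seqCode {m n : α → N} {F : α → N → N} (hm : Definable N m) (hn : Definable N n)
    (hF : Definable N fun p : α × N => F p.1 p.2) :
    Definable N fun a => seqCode (m a) (n a) (F a) :=
  .setCode (by fun_prop) (.bex (by fun_prop) (.eq (by fun_prop) (.numPair (by fun_prop)
    (hF.comp₂ (by fun_prop) (by fun_prop)))))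

section SeqCode

variable {m n : N} {F : N → N} (hF : Definable N F)

include hF

theorem isFinSet_seqCode : IsFinSet (seqCode m n F) :=
  isFinSet_setCode (.bex (by fun_prop) (by fun_prop)) _

theorem finMem_seqCode (h : ∀ i < m, F i < n) {z : N} :
    FinMem z (seqCode m n F) ↔ ∃ i < m, z = pair i (F i) := by
  rw [seqCode, finMem_setCode (.bex (by fun_prop) (by fun_prop)), and_iff_right_iff_imp]
  rintro ⟨i, hi, rfl⟩
  exact pair_lt_pair_of_add_lt (add_lt_add hi (h i hi))

theorem pair_finMem_seqCode (h : ∀ i < m, F i < n) {i x : N} :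
    FinMem (pair i x) (seqCode m n F) ↔ i < m ∧ x = F i := by
  rw [finMem_seqCode hF h]
  simp only [pair_inj]
  exact ⟨fun ⟨_, hj, hi, hx⟩ => hi ▸ ⟨hj, hx⟩, fun ⟨hi, hx⟩ => ⟨i, hi, rfl, hx⟩⟩

theorem isFinSeq_seqCode (h : ∀ i < m, F i < n) : IsFinSeq m (seqCode m n F) := by
  refine ⟨isFinSet_seqCode hF, fun z hz => ?_, fun i hi => ⟨F i, ?_, fun j hj => ?_⟩⟩
  · obtain ⟨i, hi, rfl⟩ := (finMem_seqCode hF h).1 hz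
    exact ⟨i, F i, rfl, hi⟩
  · exact (pair_finMem_seqCode hF h).2 ⟨hi, rfl⟩
  · exact ((pair_finMem_seqCode hF h).1 hj).2

end SeqCode

variable (N) in
theorem exists_nth : ∃ nth : N → N → N, Definable N (fun p : N × N => nth p.1 p.2) ∧
    ∀ s i, nth s i ≤ s ∧ ∀ x, FinMem (pair i x) s → FinMem (pair i (nth s i)) s := by
  have lt_of_finMem : ∀ {i x s : N}, FinMem (pair i x) s → x < s := fun h =>
    (right_le_pair _ _).trans_lt h.lt
  obtain ⟨nth, hnth, h⟩ := exists_definable (α := N × N)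
    (P := fun p x => x ≤ p.1 ∧ ∀ y < p.1, FinMem (pair p.2 y) p.1 → FinMem (pair p.2 x) p.1)
    (.and (by fun_prop) (.ball (by fun_prop) (.imp (by fun_prop) (by fun_prop))))
    fun ⟨s, i⟩ => by
      by_cases hx : ∃ x, FinMem (pair i x) s
      · obtain ⟨x, hx⟩ := hx
        exact ⟨x, (lt_of_finMem hx).le, fun _ _ _ => hx⟩
      · exact ⟨0, zero_le, fun y _ hy => (hx ⟨y, hy⟩).elim⟩
  exact ⟨fun s i => nth (s, i), hnth, fun s i =>
    ⟨(h (s, i)).1, fun x hx => (h (s, i)).2 x (lt_of_finMem hx) hx⟩⟩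

/-- The entry with index `i` of the finite sequence with code `s`, like Gödel's `β` function. -/
noncomputable def nth (s i : N) : N := (exists_nth N).choose s i

@[fun_prop]
theorem Definable.nth {s i : α → N} (hs : Definable N s) (hi : Definable N i) :
    Definable N fun a => nth (s a) (i a) :=
  (exists_nth N).choose_spec.1.comp₂ hs hi

theorem nth_le (s i : N) : nth s i ≤ s := ((exists_nth N).choose_spec.2 s i).1

theorem FinMem.nth {s i x : N} (h : FinMem (pair i x) s) : FinMem (pair i (nth s i)) s :=
  ((exists_nth N).choose_spec.2 s i).2 x h

theorem nth_seqCode {m n i : N} {F : N → N} (hF : Definable N F) (h : ∀ i < m, F i < n)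
    (hi : i < m) : nth (seqCode m n F) i = F i :=
  ((pair_finMem_seqCode hF h).1 ((pair_finMem_seqCode hF h).2 ⟨hi, rfl⟩).nth).2

theorem IsFinSeq.pair_finMem_iff {c s i x : N} (h : IsFinSeq c s) :
    FinMem (pair i x) s ↔ i < c ∧ x = nth s i := by
  constructor
  · intro hx
    obtain ⟨i', j, hij, hi⟩ := h.2.1 _ hx
    obtain ⟨rfl, rfl⟩ := pair_inj.1 hij
    exact ⟨hi, (h.2.2 i hi).unique hx hx.nth⟩
  · rintro ⟨hi, rfl⟩
    obtain ⟨x, hx, -⟩ := h.2.2 i hi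
    exact hx.nth

theorem IsFinSeq.ext {c s t : N} (hs : IsFinSeq c s) (ht : IsFinSeq c t)
    (h : ∀ i < c, nth s i = nth t i) : s = t := by
  have pair_iff : ∀ i x, FinMem (pair i x) s ↔ FinMem (pair i x) t := fun i x => by
    rw [hs.pair_finMem_iff, ht.pair_finMem_iff]
    exact and_congr_right fun hi => by rw [h i hi]
  refine hs.1.ext ht.1 fun z => ⟨fun hz => ?_, fun hz => ?_⟩
  · obtain ⟨i, x, rfl, -⟩ := hs.2.1 z hz
    exact (pair_iff i x).1 hz
  · obtain ⟨i, x, rfl, -⟩ := ht.2.1 z hz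
    exact (pair_iff i x).2 hz

/-- The first `n + 1` entries of `s` satisfy the recursion with start value `g` and step `h`. -/
def IsApprox (g : N) (h : N → N → N) (n s : N) : Prop :=
  nth s 0 = g ∧ ∀ i < n, nth s (i + 1) = h i (nth s i)

theorem Definable.isApprox {g n s : α → N} {h : α → N → N → N} (hg : Definable N g)
    (hn : Definable N n) (hs : Definable N s)
    (hh : Definable N fun p : (α × N) × N => h p.1.1 p.1.2 p.2) :
    Definable N fun a => IsApprox (g a) (h a) (n a) (s a) :=
  .and (by fun_prop) (.ball (by fun_prop) (.eq (by fun_prop)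
    (hh.comp₃ (by fun_prop) (by fun_prop) (by fun_prop))))

theorem IsApprox.nth_eq {g n n' s s' : N} {h : N → N → N} (H : IsApprox g h n s)
    (H' : IsApprox g h n' s') (i : N) : i ≤ n → i ≤ n' → nth s i = nth s' i := by
  refine definable_induction (P := fun i => i ≤ n → i ≤ n' → nth s i = nth s' i)
    (.imp (by fun_prop) (.imp (by fun_prop) (by fun_prop))) (fun _ _ => H.1.trans H'.1.symm) ?_ i
  intro i ih hi hi'
  rw [H.2 i (Order.add_one_le_iff.1 hi), H'.2 i (Order.add_one_le_iff.1 hi'),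
    ih (le_self_add.trans hi) (le_self_add.trans hi')]

open Classical in
theorem exists_isApprox (g : N) {h : N → N → N} (hh : Definable N fun p : N × N => h p.1 p.2)
    (n : N) : ∃ s, IsApprox g h n s := by
  refine sigma_induction (P := IsApprox g h) ?_ ?_ ?_ n
  · exact .isApprox (h := fun _ => h) (by fun_prop) (by fun_prop) (by fun_prop)
      (hh.comp₂ (by fun_prop) (by fun_prop))
  · refine ⟨seqCode 1 (g + 1) fun _ => g, ?_, fun i hi => (not_lt_zero hi).elim⟩
    exact nth_seqCode (by fun_prop) (fun _ _ => lt_add_one g) one_pos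
  rintro n ⟨s, hs⟩
  let F i := if i ≤ n then nth s i else h n (nth s n)
  have hF : Definable N F := .ite (by fun_prop) (by fun_prop) (by fun_prop)
  have F_lt : ∀ i < n + 1 + 1, F i < s + h n (nth s n) + 1 := fun i _ => by
    rw [Order.lt_add_one_iff]
    by_cases hi : i ≤ n
    · exact (if_pos hi).trans_le ((nth_le s i).trans le_self_add)
    · exact (if_neg hi).trans_le le_add_self
  have nth_F {i : N} (hi : i ≤ n + 1) : nth (seqCode (n + 1 + 1) _ F) i = F i :=
    nth_seqCode hF F_lt (Order.lt_add_one_iff.2 hi)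
  refine ⟨seqCode (n + 1 + 1) _ F, (nth_F zero_le).trans ((if_pos zero_le).trans hs.1), ?_⟩
  intro i hi
  have hin := Order.lt_add_one_iff.1 hi
  rw [nth_F (Order.add_one_le_iff.2 hi), nth_F hi.le, show F i = nth s i from if_pos hin]
  rcases hin.lt_or_eq with hin | rfl
  · exact (if_pos (Order.add_one_le_iff.2 hin)).trans (hs.2 i hin)
  · exact if_neg (lt_add_one i).not_ge

theorem exists_recursion {g : α → N} {h : α → N → N → N} (hg : Definable N g)
    (hh : Definable N fun p : (α × N) × N => h p.1.1 p.1.2 p.2) :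
    ∃ F : α → N → N, Definable N (fun p : α × N => F p.1 p.2) ∧ (∀ a, F a 0 = g a) ∧
      ∀ a n, F a (n + 1) = h a n (F a n) := by
  obtain ⟨s, hs, H⟩ := exists_definable (α := α × N)
    (P := fun p s => IsApprox (g p.1) (h p.1) p.2 s)
    (.isApprox (h := fun p : (α × N) × N => h p.1.1) (by fun_prop) (by fun_prop) (by fun_prop)
      (hh.comp₃ (by fun_prop) (by fun_prop) (by fun_prop)))
    fun p => exists_isApprox _ (hh.comp₃ (by fun_prop) (by fun_prop) (by fun_prop)) _
  refine ⟨fun a n => nth (s (a, n)) n, by fun_prop, fun a => (H (a, 0)).1, fun a n => ?_⟩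
  change nth (s (a, n + 1)) (n + 1) = h a n (nth (s (a, n)) n)
  rw [(H (a, n + 1)).2 n (lt_add_one n),
    (H (a, n)).nth_eq (H (a, n + 1)) n le_rfl (lt_add_one n).le]

end FinSeq

section Morphisms

variable {N : Type u} [Model N] {α : Type v} [Codable N α]

/-! ### Increasing functions and their codes -/

/-- The definable function `F` restricts to a morphism from `m` to `n` in the category `Nat`. Its
values at arguments `i ≥ m` are arbitrary. -/
structure IsIncFun (m n : N) (F : N → N) : Prop where
  definable : Definable N F
  lt : ∀ i < m, F i < n
  mono : ∀ i j, i < j → j < m → F i < F j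

namespace IsIncFun

variable {k l m n m' n' : N} {F G : N → N}

theorem le_of_apply_le (h : IsIncFun m n F) {i j : N} (hi : i < m) (hij : F i ≤ F j) : i ≤ j :=
  not_lt.1 fun hji => hij.not_gt (h.mono _ _ hji hi)

theorem lt_of_apply_lt (h : IsIncFun m n F) {i j : N} (hi : i < m) (hij : F i < F j) : i < j :=
  (h.le_of_apply_le hi hij.le).lt_of_ne fun heq => hij.ne (congrArg F heq)

theorem inj (h : IsIncFun m n F) {i j : N} (hi : i < m) (hj : j < m) (hij : F i = F j) : i = j :=
  le_antisymm (h.le_of_apply_le hi hij.le) (h.le_of_apply_le hj hij.ge)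

protected theorem id (h : m ≤ n) : IsIncFun m n fun i => i :=
  ⟨by fun_prop, fun _ hi => hi.trans_le h, fun _ _ h _ => h⟩

theorem comp (hG : IsIncFun m n G) (hF : IsIncFun l m F) : IsIncFun l n fun i => G (F i) :=
  ⟨hG.definable.comp hF.definable, fun i hi => hG.lt _ (hF.lt i hi),
    fun i j hij hj => hG.mono _ _ (hF.mono i j hij hj) (hF.lt j hj)⟩

theorem exists_factor (hF : IsIncFun k n F) (hG : IsIncFun l n' G)
    (h : ∀ i < k, ∃ j < l, G j = F i) : ∃ H, IsIncFun k l H ∧ ∀ i < k, G (H i) = F i := by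
  have hFd := hF.definable
  have hGd := hG.definable
  obtain ⟨H, hHd, hH⟩ := exists_definable (P := fun i j : N => i < k → j < l ∧ G j = F i)
    (.imp (by fun_prop) (by fun_prop)) fun i => by
      by_cases hi : i < k
      · obtain ⟨j, hj⟩ := h i hi
        exact ⟨j, fun _ => hj⟩
      · exact ⟨0, fun hi' => (hi hi').elim⟩
  refine ⟨H, ⟨hHd, fun i hi => (hH i hi).1, fun i j hij hj => ?_⟩, fun i hi => (hH i hi).2⟩
  have hi := hij.trans hj
  refine hG.lt_of_apply_lt (hH i hi).1 ?_
  rw [(hH i hi).2, (hH j hj).2]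
  exact hF.mono i j hij hj

theorem le_apply (hF : IsIncFun m n F) (i : N) : i < m → i ≤ F i := by
  have hFd := hF.definable
  refine definable_induction (P := fun i => i < m → i ≤ F i) (.imp (by fun_prop) (by fun_prop))
    (fun _ => zero_le) (fun i ih hi => Order.add_one_le_iff.2 ?_) i
  exact (ih ((lt_add_one i).trans hi)).trans_lt (hF.mono _ _ (lt_add_one i) hi)

theorem dom_le_cod (hF : IsIncFun m n F) : m ≤ n :=
  not_lt.1 fun h => (hF.lt n h).not_ge (hF.le_apply n h)

theorem le_of_range_subset (hF : IsIncFun m n F) (hG : IsIncFun m n' G)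
    (h : ∀ i < m, ∃ j < m, G j = F i) {i : N} (hi : i < m) : G i ≤ F i := by
  obtain ⟨H, hH, hHF⟩ := hF.exists_factor hG h
  rw [← hHF i hi]
  rcases (hH.le_apply i hi).lt_or_eq with hlt | heq
  · exact (hG.mono _ _ hlt (hH.lt i hi)).le
  · rw [← heq]

theorem eq_of_range (hF : IsIncFun m n F) (hG : IsIncFun m' n' G)
    (h : ∀ i < m, ∃ j < m', G j = F i) (h' : ∀ j < m', ∃ i < m, F i = G j) :
    m = m' ∧ ∀ i < m, F i = G i := by
  obtain ⟨_, hH, -⟩ := hF.exists_factor hG h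
  obtain ⟨_, hH', -⟩ := hG.exists_factor hF h'
  obtain rfl := le_antisymm hH.dom_le_cod hH'.dom_le_cod
  exact ⟨rfl, fun i hi =>
    le_antisymm (hG.le_of_range_subset hF h' hi) (hF.le_of_range_subset hG h hi)⟩

end IsIncFun

/-- The code of the morphism of `Nat` from `m` to `n` with values `F i` for `i < m`. -/
noncomputable def morCode (m n : N) (F : N → N) : N := pair m (pair n (seqCode m n F))

theorem Definable.morCode {m n : α → N} {F : α → N → N} (hm : Definable N m) (hn : Definable N n)
    (hF : Definable N fun p : α × N => F p.1 p.2) :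
    Definable N fun a => morCode (m a) (n a) (F a) :=
  hm.numPair (hn.numPair (.seqCode hm hn hF))

section MorCode

variable {l m n : N} {F G H : N → N}

theorem morCode_congr (h : ∀ i < m, F i = G i) : morCode m n F = morCode m n G := by
  have values_iff (z : N) : (∃ i < m, z = pair i (F i)) ↔ ∃ i < m, z = pair i (G i) :=
    exists_congr fun i => and_congr_right fun hi => by rw [h i hi]
  simp only [morCode, seqCode, values_iff]

theorem app_morCode (hF : IsIncFun m n F) {i j : N} :
    App (morCode m n F) i j ↔ i < m ∧ j = F i := by
  rw [← pair_finMem_seqCode hF.definable hF.lt]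
  refine ⟨?_, fun h => ⟨_, _, _, rfl, h⟩⟩
  rintro ⟨m', n', s, hs, h⟩
  rwa [(pair_inj.1 (pair_inj.1 hs).2).2]

theorem IsIncFun.isMor (hF : IsIncFun m n F) : IsMor m n (morCode m n F) := by
  refine ⟨_, rfl, isFinSeq_seqCode hF.definable hF.lt, fun i j h => ?_, fun i i' j j' h h' hi => ?_⟩
  · rw [pair_finMem_seqCode hF.definable hF.lt] at h
    exact h.2 ▸ hF.lt i h.1
  · rw [pair_finMem_seqCode hF.definable hF.lt] at h h'
    rw [h.2, h'.2]
    exact hF.mono _ _ hi h'.1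

theorem IsMor.exists_eq_morCode {f : N} (h : IsMor m n f) :
    ∃ F, IsIncFun m n F ∧ f = morCode m n F := by
  obtain ⟨s, rfl, hs, hlt, hmono⟩ := h
  have mem_s {i : N} (hi : i < m) : FinMem (pair i (nth s i)) s := hs.pair_finMem_iff.2 ⟨hi, rfl⟩
  have hF : IsIncFun m n (nth s) := ⟨by fun_prop, fun i hi => hlt i _ (mem_s hi),
    fun i j hij hj => hmono i j _ _ (mem_s (hij.trans hj)) (mem_s hj) hij⟩
  have s_eq : s = seqCode m n (nth s) := hs.ext (isFinSeq_seqCode hF.definable hF.lt) fun i hi =>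
    (nth_seqCode hF.definable hF.lt hi).symm
  exact ⟨nth s, hF, congrArg (fun t => pair m (pair n t)) s_eq⟩

theorem isIncl_morCode (hF : IsIncFun m n F) : IsIncl (morCode m n F) ↔ ∀ i < m, F i = i := by
  simp only [IsIncl, app_morCode hF]
  exact ⟨fun h i hi => h i _ ⟨hi, rfl⟩, fun h i j ⟨hi, hj⟩ => hj.trans (h i hi)⟩

theorem isComp_morCode (hF : IsIncFun l m F) (hG : IsIncFun m n G) (hH : IsIncFun l n H) :
    IsComp (morCode l m F) (morCode m n G) (morCode l n H) ↔ ∀ i < l, G (F i) = H i := by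
  simp only [IsComp, app_morCode hF, app_morCode hG, app_morCode hH]
  constructor
  · exact fun h i hi => (h i _ _ ⟨hi, rfl⟩ ⟨hF.lt i hi, rfl⟩).2
  · rintro h i j k ⟨hi, rfl⟩ ⟨-, rfl⟩
    exact ⟨hi, h i hi⟩

end MorCode

end Morphisms

section Enumeration

variable {N : Type u} [Model N] {α : Type v} [Codable N α]

/-! ### Enumerations of finite sets -/

variable (N) in
open Classical in
theorem exists_count : ∃ count : N → N → N, Definable N (fun p : N × N => count p.1 p.2) ∧
    (∀ a, count a 0 = 0) ∧
      ∀ a k, count a (k + 1) = if FinMem k a then count a k + 1 else count a k :=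
  exists_recursion (α := N) (g := fun _ => 0) (h := fun a k x => if FinMem k a then x + 1 else x)
    (by fun_prop) (.ite (by fun_prop) (by fun_prop) (by fun_prop))

/-- The number of elements below `k` of the finite set with code `a`. -/
noncomputable def count (a k : N) : N := (exists_count N).choose a k

@[fun_prop]
theorem Definable.count {a k : α → N} (ha : Definable N a) (hk : Definable N k) :
    Definable N fun x => count (a x) (k x) :=
  (exists_count N).choose_spec.1.comp₂ ha hk

theorem count_zero (a : N) : count a 0 = 0 := (exists_count N).choose_spec.2.1 a

theorem count_add_one_of_finMem {a k : N} (h : FinMem k a) : count a (k + 1) = count a k + 1 :=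
  ((exists_count N).choose_spec.2.2 a k).trans (if_pos h)

theorem count_add_one_of_not_finMem {a k : N} (h : ¬ FinMem k a) : count a (k + 1) = count a k :=
  ((exists_count N).choose_spec.2.2 a k).trans (if_neg h)

theorem count_mono (a : N) {j k : N} : j ≤ k → count a j ≤ count a k := by
  refine definable_induction (P := fun k => j ≤ k → count a j ≤ count a k)
    (.imp (by fun_prop) (by fun_prop)) (fun hj => (congrArg _ (nonpos_iff_eq_zero.1 hj)).le)
    (fun k ih hj => ?_) k
  rcases hj.lt_or_eq with hj | rfl
  · refine (ih (Order.lt_add_one_iff.1 hj)).trans ?_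
    by_cases h : FinMem k a
    · exact le_self_add.trans (count_add_one_of_finMem h).ge
    · exact (count_add_one_of_not_finMem h).ge
  · exact le_rfl

theorem count_lt_count {a j k : N} (hj : FinMem j a) (hjk : j < k) : count a j < count a k :=
  (lt_add_one _).trans_le
    ((count_add_one_of_finMem hj).ge.trans (count_mono a (Order.add_one_le_iff.2 hjk)))

theorem count_inj {a x y : N} (hx : FinMem x a) (hy : FinMem y a) (h : count a x = count a y) :
    x = y :=
  le_antisymm (not_lt.1 fun hlt => (count_lt_count hy hlt).ne' h)
    (not_lt.1 fun hlt => (count_lt_count hx hlt).ne h)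

theorem exists_count_eq {a i k : N} : i < count a k → ∃ x < k, FinMem x a ∧ count a x = i := by
  refine definable_induction (P := fun k => i < count a k → ∃ x < k, FinMem x a ∧ count a x = i)
    (.imp (by fun_prop) (.bex (by fun_prop) (by fun_prop)))
    (fun h => (not_lt_zero (h.trans_eq (count_zero a))).elim) (fun k ih hi => ?_) k
  by_cases hk : FinMem k a
  · rw [count_add_one_of_finMem hk, Order.lt_add_one_iff] at hi
    rcases hi.lt_or_eq with hi | rfl
    · exact (ih hi).imp fun x hx => ⟨hx.1.trans (lt_add_one k), hx.2⟩
    · exact ⟨k, lt_add_one k, hk, rfl⟩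
  · rw [count_add_one_of_not_finMem hk] at hi
    exact (ih hi).imp fun x hx => ⟨hx.1.trans (lt_add_one k), hx.2⟩

/-- The cardinality of the finite set with code `a`, whose elements are all below `a`. -/
noncomputable def card (a : N) : N := count a a

@[fun_prop]
theorem Definable.card {f : α → N} (hf : Definable N f) : Definable N fun a => card (f a) := by
  unfold SOA.card; fun_prop

variable (N) in
theorem exists_enum : ∃ enum : N → N → N, Definable N (fun p : N × N => enum p.1 p.2) ∧
    ∀ a, ∀ i < card a, FinMem (enum a i) a ∧ count a (enum a i) = i := by
  obtain ⟨enum, henum, h⟩ := exists_definable (α := N × N)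
    (P := fun p x => p.2 < card p.1 → FinMem x p.1 ∧ count p.1 x = p.2)
    (.imp (by fun_prop) (by fun_prop)) fun p => by
      by_cases hp : p.2 < card p.1
      · obtain ⟨x, -, hx⟩ := exists_count_eq hp
        exact ⟨x, fun _ => hx⟩
      · exact ⟨0, fun hp' => (hp hp').elim⟩
  exact ⟨fun a i => enum (a, i), henum, fun a i => h (a, i)⟩

/-- The element with index `i` in the increasing enumeration of the finite set with code `a`. -/
noncomputable def enum (a i : N) : N := (exists_enum N).choose a i

@[fun_prop]
theorem Definable.enum {a i : α → N} (ha : Definable N a) (hi : Definable N i) :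
    Definable N fun x => enum (a x) (i x) :=
  (exists_enum N).choose_spec.1.comp₂ ha hi

theorem finMem_enum {a i : N} (hi : i < card a) : FinMem (enum a i) a :=
  ((exists_enum N).choose_spec.2 a i hi).1

theorem count_enum {a i : N} (hi : i < card a) : count a (enum a i) = i :=
  ((exists_enum N).choose_spec.2 a i hi).2

theorem finMem_iff_enum {a x : N} : FinMem x a ↔ ∃ i < card a, enum a i = x := by
  refine ⟨fun hx => ?_, fun ⟨_, hi, h⟩ => h ▸ finMem_enum hi⟩
  have hlt : count a x < card a := count_lt_count hx hx.lt
  exact ⟨_, hlt, count_inj (finMem_enum hlt) hx (count_enum hlt)⟩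

theorem isIncFun_enum {a n : N} (h : ∀ x : N, FinMem x a → x < n) :
    IsIncFun (card a) n (enum a) := by
  refine ⟨by fun_prop, fun i hi => h _ (finMem_enum hi), fun i j hij hj => not_le.1 fun hle => ?_⟩
  have := count_mono a hle
  rw [count_enum hj, count_enum (hij.trans hj)] at this
  exact this.not_gt hij

theorem isIncFun_enum_self (a : N) : IsIncFun (card a) a (enum a) :=
  isIncFun_enum fun _ => FinMem.lt

theorem pair_finMem_seqCode_enum {a i x : N} :
    FinMem (pair i x) (seqCode (card a) a (enum a)) ↔ i < card a ∧ x = enum a i :=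
  pair_finMem_seqCode (by fun_prop) (isIncFun_enum_self a).lt

theorem isEnum_seqCode {a : N} (ha : IsFinSet a) :
    IsEnum (· < ·) a (card a) (seqCode (card a) a (enum a)) := by
  have h := isIncFun_enum_self a
  refine ⟨ha, isFinSeq_seqCode h.definable h.lt, fun x => ?_, fun i i' x x' hi hi' hii' => ?_⟩
  · simp only [pair_finMem_seqCode_enum, eq_comm (a := x)]
    exact finMem_iff_enum
  · obtain ⟨-, rfl⟩ := pair_finMem_seqCode_enum.1 hi
    obtain ⟨hj, rfl⟩ := pair_finMem_seqCode_enum.1 hi'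
    exact h.mono _ _ hii' hj

theorem IsEnum.eq_card_and_eq_seqCode {a c s : N} (h : IsEnum (· < ·) a c s) :
    c = card a ∧ s = seqCode (card a) a (enum a) := by
  obtain ⟨ha, hs, mem_iff, mono⟩ := h
  simp only [hs.pair_finMem_iff] at mem_iff mono
  have hnth : IsIncFun c a (nth s) := ⟨by fun_prop, fun i hi => ((mem_iff _).2 ⟨i, hi, rfl⟩).lt,
    fun i j hij hj => mono i j _ _ ⟨hij.trans hj, rfl⟩ ⟨hj, rfl⟩ hij⟩
  obtain ⟨rfl, heq⟩ := hnth.eq_of_range (isIncFun_enum_self a)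
    (fun i hi => finMem_iff_enum.1 ((mem_iff _).2 ⟨i, hi, rfl⟩))
    (fun j hj => ((mem_iff _).1 (finMem_enum hj)).imp fun _ h => ⟨h.1, h.2.symm⟩)
  refine ⟨rfl, hs.ext (isEnum_seqCode ha).2.1 fun i hi => (heq i hi).trans ?_⟩
  exact (nth_seqCode (by fun_prop) (isIncFun_enum_self a).lt hi).symm

theorem isCard_iff {a c : N} (ha : IsFinSet a) : IsCard (· < ·) a c ↔ c = card a :=
  ⟨fun ⟨_, h⟩ => h.eq_card_and_eq_seqCode.1, fun h => ⟨_, h ▸ isEnum_seqCode ha⟩⟩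

theorem isInclMor_iff {a b f : N} (ha : IsFinSet a) (hb : IsFinSet b) :
    IsInclMor (· < ·) a b f ↔ ∃ H, IsIncFun (card a) (card b) H ∧
      f = morCode (card a) (card b) H ∧ ∀ i < card a, enum b (H i) = enum a i := by
  constructor
  · rintro ⟨c, d, s, t, hs, ht, hf, hst⟩
    obtain ⟨rfl, rfl⟩ := hs.eq_card_and_eq_seqCode
    obtain ⟨rfl, rfl⟩ := ht.eq_card_and_eq_seqCode
    obtain ⟨H, hH, rfl⟩ := hf.exists_eq_morCode
    simp only [app_morCode hH, pair_finMem_seqCode_enum] at hst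
    exact ⟨H, hH, rfl, fun i hi => (hst i _ _ ⟨hi, rfl⟩ ⟨hi, rfl⟩).2.symm⟩
  · rintro ⟨H, hH, rfl, h⟩
    refine ⟨_, _, _, _, isEnum_seqCode ha, isEnum_seqCode hb, hH.isMor, ?_⟩
    simp only [app_morCode hH, pair_finMem_seqCode_enum]
    rintro i _ _ ⟨hi, rfl⟩ ⟨-, rfl⟩
    exact ⟨hH.lt i hi, (h i hi).symm⟩

end Enumeration

section Dilator

variable {N : Type u} [Model N] {α : Type v} [Codable N α] {D : Set N}

/-! ### Goodstein dilators -/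

@[fun_prop]
theorem Definable.objMem (hD : D ∈ sets (N := N)) {f g : α → N} (hf : Definable N f)
    (hg : Definable N g) : Definable N fun a => ObjMem D (f a) (g a) := by
  unfold ObjMem; fun_prop (disch := assumption)

@[fun_prop]
theorem Definable.mapTo (hD : D ∈ sets (N := N)) {f g h : α → N} (hf : Definable N f)
    (hg : Definable N g) (hh : Definable N h) :
    Definable N fun a => MapTo D (f a) (g a) (h a) := by
  unfold MapTo; fun_prop (disch := assumption)

variable {k l m n m' σ τ ρ σ' τ' : N} {F G H P Q : N → N}

namespace IsFunctor

variable (hD : IsFunctor D)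

include hD

theorem exists_mapTo (hF : IsIncFun m n F) (hσ : ObjMem D m σ) :
    ∃ τ, MapTo D (morCode m n F) σ τ :=
  (hD.map_total m n _ σ hF.isMor hσ).exists

theorem mapTo_dom (hF : IsIncFun m n F) (h : MapTo D (morCode m n F) σ τ) : ObjMem D m σ :=
  (hD.map_mem m n _ σ τ hF.isMor h).1

theorem mapTo_cod (hF : IsIncFun m n F) (h : MapTo D (morCode m n F) σ τ) : ObjMem D n τ :=
  (hD.map_mem m n _ σ τ hF.isMor h).2

theorem mapTo_unique (hF : IsIncFun m n F) (h : MapTo D (morCode m n F) σ τ)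
    (h' : MapTo D (morCode m n F) σ τ') : τ = τ' :=
  (hD.map_total m n _ σ hF.isMor (hD.mapTo_dom hF h)).unique h h'

theorem mapTo_comp (hF : IsIncFun l m F) (hG : IsIncFun m n G) (hH : IsIncFun l n H)
    (comm : ∀ i < l, G (F i) = H i) (h : MapTo D (morCode l m F) σ τ)
    (h' : MapTo D (morCode m n G) τ ρ) : MapTo D (morCode l n H) σ ρ :=
  hD.map_comp l m n _ _ _ σ τ ρ hF.isMor hG.isMor hH.isMor ((isComp_morCode hF hG hH).2 comm) h h'

theorem mapTo_of_comp (hF : IsIncFun l m F) (hG : IsIncFun m n G) (hH : IsIncFun l n H)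
    (comm : ∀ i < l, G (F i) = H i) (h : MapTo D (morCode l m F) σ τ)
    (h' : MapTo D (morCode l n H) σ ρ) : MapTo D (morCode m n G) τ ρ := by
  obtain ⟨ρ', hρ'⟩ := hD.exists_mapTo hG (hD.mapTo_cod hF h)
  rwa [hD.mapTo_unique hH h' (hD.mapTo_comp hF hG hH comm h hρ')]

theorem mapTo_id (hσ : ObjMem D n σ) : MapTo D (morCode n n fun i => i) σ σ :=
  have hid := IsIncFun.id le_rfl
  hD.map_id n _ σ hid.isMor ((isIncl_morCode hid).2 fun _ _ => rfl) hσ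

theorem exists_mapTo_of_range (hF : IsIncFun m n F) (hG : IsIncFun l n G)
    (h : ∀ i < m, ∃ j < l, G j = F i) (hτ : MapTo D (morCode m n F) σ τ) :
    ∃ ρ, MapTo D (morCode l n G) ρ τ := by
  obtain ⟨H, hH, comm⟩ := hF.exists_factor hG h
  obtain ⟨ρ, hρ⟩ := hD.exists_mapTo hH (hD.mapTo_dom hF hτ)
  exact ⟨ρ, hD.mapTo_of_comp hH hG hF comm hρ hτ⟩

end IsFunctor

theorem isNatPullback_of_range (hF : IsIncFun m n F) (hG : IsIncFun m' n G) (hH : IsIncFun l n H)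
    (hP : IsIncFun l m P) (hQ : IsIncFun l m' Q) (hPF : ∀ i < l, F (P i) = H i)
    (hQG : ∀ i < l, G (Q i) = H i)
    (inter : ∀ x, (∃ i < m, F i = x) → (∃ i < m', G i = x) → ∃ i < l, H i = x) :
    IsNatPullback l m m' n (morCode l m P) (morCode l m' Q) (morCode m n F) (morCode m' n G) := by
  refine ⟨hP.isMor, hQ.isMor, hF.isMor, hG.isMor,
    ⟨_, hH.isMor, (isComp_morCode hP hF hH).2 hPF, (isComp_morCode hQ hG hH).2 hQG⟩, ?_⟩
  rintro k j j' hj hj' ⟨d, hd, hjd, hjd'⟩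
  obtain ⟨J, hJ, rfl⟩ := hj.exists_eq_morCode
  obtain ⟨J', hJ', rfl⟩ := hj'.exists_eq_morCode
  obtain ⟨E, hE, rfl⟩ := hd.exists_eq_morCode
  rw [isComp_morCode hJ hF hE] at hjd
  rw [isComp_morCode hJ' hG hE] at hjd'
  obtain ⟨K, hK, hKE⟩ := hE.exists_factor hH fun i hi =>
    inter _ ⟨_, hJ.lt i hi, hjd i hi⟩ ⟨_, hJ'.lt i hi, hjd' i hi⟩
  refine ⟨morCode k l K, ⟨hK.isMor, (isComp_morCode hK hP hJ).2 fun i hi => ?_,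
    (isComp_morCode hK hQ hJ').2 fun i hi => ?_⟩, ?_⟩
  · refine hF.inj (hP.lt _ (hK.lt i hi)) (hJ.lt i hi) ?_
    rw [hPF _ (hK.lt i hi), hKE i hi, hjd i hi]
  · refine hG.inj (hQ.lt _ (hK.lt i hi)) (hJ'.lt i hi) ?_
    rw [hQG _ (hK.lt i hi), hKE i hi, hjd' i hi]
  · rintro h ⟨hh, hhJ, -⟩
    obtain ⟨K', hK', rfl⟩ := hh.exists_eq_morCode
    rw [isComp_morCode hK' hP hJ] at hhJ
    refine morCode_congr fun i hi => hH.inj (hK'.lt i hi) (hK.lt i hi) ?_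
    rw [hKE i hi, ← hPF _ (hK'.lt i hi), hhJ i hi, hjd i hi]

/-- The code of the linear order with `0` as its only element. -/
def singletonOrd (N : Type u) [Model N] : Set N := {z | z = pair 0 0}

theorem singleton_mem_sets (x : N) : {z : N | z = x} ∈ sets := Definable.mem_sets (by fun_prop)

theorem ordMem_singletonOrd {x : N} : OrdMem (singletonOrd N) x ↔ x = 0 := by
  simp [OrdMem, singletonOrd, pair_inj]

theorem not_ordLt_singletonOrd {x y : N} : ¬ OrdLt (singletonOrd N) x y := by
  simp [OrdLt, singletonOrd, pair_inj]

theorem isLinOrd_singletonOrd : IsLinOrd (OrdMem (singletonOrd N)) (OrdLt (singletonOrd N)) :=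
  ⟨fun _ _ h => (not_ordLt_singletonOrd h).elim, fun _ => not_ordLt_singletonOrd,
    fun _ _ _ h => (not_ordLt_singletonOrd h).elim, fun _ _ hx hy =>
      .inr (.inl ((ordMem_singletonOrd.1 hx).trans (ordMem_singletonOrd.1 hy).symm))⟩

theorem isEmb_singletonOrd (hσ : ObjMem D m σ) : IsEmb (OrdMem (singletonOrd N))
    (OrdLt (singletonOrd N)) (ObjMem D m) (ObjLt D m) {z : N | z = pair 0 σ} := by
  refine ⟨?_, fun x hx => ?_, fun _ _ _ _ _ _ h => (not_ordLt_singletonOrd h).elim⟩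
  · rintro z rfl
    exact ⟨0, σ, rfl, ordMem_singletonOrd.2 rfl, hσ⟩
  · obtain rfl := ordMem_singletonOrd.1 hx
    exact ⟨σ, rfl, fun y hy => (pair_inj.1 hy).2⟩

namespace IsGoodsteinDilator

variable (hD : IsGoodsteinDilator sets D)

include hD

theorem mapTo_lt (hF : IsIncFun m n F) (h : MapTo D (morCode m n F) σ τ)
    (h' : MapTo D (morCode m n F) σ' τ') (hlt : σ < σ') : τ < τ' :=
  have hfun := hD.isFunctor
  (hD.usual_order n _ _ (hfun.mapTo_cod hF h) (hfun.mapTo_cod hF h')).1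
    (hfun.map_lt m n _ _ _ _ _ hF.isMor h h'
      ((hD.usual_order m _ _ (hfun.mapTo_dom hF h) (hfun.mapTo_dom hF h')).2 hlt))

theorem mapTo_le (hF : IsIncFun m n F) (h : MapTo D (morCode m n F) σ τ)
    (h' : MapTo D (morCode m n F) σ' τ') (hle : σ ≤ σ') : τ ≤ τ' := by
  rcases hle.lt_or_eq with hlt | rfl
  · exact (hD.mapTo_lt hF h h' hlt).le
  · exact (hD.isFunctor.mapTo_unique hF h h').le

theorem lt_of_mapTo_lt (hF : IsIncFun m n F) (h : MapTo D (morCode m n F) σ τ)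
    (h' : MapTo D (morCode m n F) σ' τ') (hlt : τ < τ') : σ < σ' :=
  not_le.1 fun hle => (hD.mapTo_le hF h' h hle).not_gt hlt

theorem mapTo_injective (hF : IsIncFun m n F) (h : MapTo D (morCode m n F) σ τ)
    (h' : MapTo D (morCode m n F) σ' τ) : σ = σ' :=
  le_antisymm (not_lt.1 fun hlt => (hD.mapTo_lt hF h' h hlt).false)
    (not_lt.1 fun hlt => (hD.mapTo_lt hF h h' hlt).false)

theorem mapTo_zero (hF : IsIncFun m n F) : MapTo D (morCode m n F) 0 0 := by
  have empty (n : N) : IsIncFun 0 n fun i => i := .id zero_le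
  exact hD.isFunctor.mapTo_of_comp (empty m) hF (empty n) (fun i hi => (not_lt_zero hi).elim)
    (hD.map_zero m _ (empty m).isMor) (hD.map_zero n _ (empty n).isMor)

theorem le_of_mapTo (hDS : D ∈ sets (N := N)) (hF : IsIncFun m n F)
    (h : MapTo D (morCode m n F) σ τ) : σ ≤ τ := by
  obtain ⟨T, hTd, hT⟩ := exists_definable
    (P := fun σ τ => ObjMem D m σ → MapTo D (morCode m n F) σ τ)
    (.imp (by fun_prop (disch := assumption)) (by fun_prop (disch := assumption))) fun σ => by
      by_cases hσ : ObjMem D m σ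
      · obtain ⟨τ, hτ⟩ := hD.isFunctor.exists_mapTo hF hσ
        exact ⟨τ, fun _ => hτ⟩
      · exact ⟨0, fun h => (hσ h).elim⟩
  have le_T : ∀ σ, ObjMem D m σ → σ ≤ T σ := by
    refine definable_induction (.imp (by fun_prop (disch := assumption)) (by fun_prop))
      (fun _ => zero_le) fun σ ih hσ => ?_
    have hσ' := hD.initial m _ _ hσ (lt_add_one σ)
    exact Order.add_one_le_iff.2 ((ih hσ').trans_lt
      (hD.mapTo_lt hF (hT _ hσ') (hT _ hσ) (lt_add_one σ)))
  have hσ := hD.isFunctor.mapTo_dom hF h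
  exact (le_T σ hσ).trans_eq (hD.isFunctor.mapTo_unique hF (hT σ hσ) h)

/-- Preservation of pullbacks is applied to two embeddings of a one-point order. -/
theorem exists_mapTo_of_inter (hF : IsIncFun m n F) (hG : IsIncFun m' n G) (hH : IsIncFun l n H)
    (inter : ∀ x, (∃ i < l, H i = x) ↔ (∃ i < m, F i = x) ∧ ∃ i < m', G i = x)
    (h : MapTo D (morCode m n F) σ τ) (h' : MapTo D (morCode m' n G) σ' τ) :
    ∃ ρ, MapTo D (morCode l n H) ρ τ := by
  have hfun := hD.isFunctor
  obtain ⟨P, hP, hPF⟩ := hH.exists_factor hF fun i hi => ((inter _).1 ⟨i, hi, rfl⟩).1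
  obtain ⟨Q, hQ, hQG⟩ := hH.exists_factor hG fun i hi => ((inter _).1 ⟨i, hi, rfl⟩).2
  have pullback := isNatPullback_of_range hF hG hH hP hQ hPF hQG fun x hx hx' =>
    (inter x).2 ⟨hx, hx'⟩
  have agree : AgreeAfter D (morCode m n F) (morCode m' n G) {z | z = pair 0 σ}
      {z | z = pair 0 σ'} := by
    rintro x y y' τ' hxy hxy'
    obtain ⟨-, rfl⟩ := pair_inj.1 hxy
    obtain ⟨-, rfl⟩ := pair_inj.1 hxy'
    exact ⟨fun hτ' => hfun.mapTo_unique hF h hτ' ▸ h', fun hτ' => hfun.mapTo_unique hG h' hτ' ▸ h⟩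
  obtain ⟨K, ⟨-, hK, hKP, -⟩, -⟩ := hD.preserves_pullbacks _ _ _ _ _ _ _ _ pullback _
    (singleton_mem_sets (pair 0 0)) isLinOrd_singletonOrd _ (singleton_mem_sets (pair 0 σ)) _
    (singleton_mem_sets (pair 0 σ')) (isEmb_singletonOrd (hfun.mapTo_dom hF h))
    (isEmb_singletonOrd (hfun.mapTo_dom hG h')) agree
  obtain ⟨ρ, hρ, -⟩ := hK.2.1 0 (ordMem_singletonOrd.2 rfl)
  exact ⟨ρ, hfun.mapTo_comp hP hF hH hPF (hKP 0 ρ σ hρ rfl) h⟩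

end IsGoodsteinDilator

end Dilator

section Support

variable {N : Type u} [Model N] {α : Type v} [Codable N α] {D U : Set N}
variable {m n a σ τ ρ : N} {F G : N → N} {P Q : N → Prop}

/-! ### Supports -/

/-- The inclusion `|a| → n` of a finite set `a ⊆ {0,…,n-1}`, as a morphism of natural numbers. -/
noncomputable def setIncl (n a : N) : N := morCode (card a) n (enum a)

@[fun_prop]
theorem Definable.setIncl {f g : α → N} (hf : Definable N f) (hg : Definable N g) :
    Definable N fun x => setIncl (f x) (g x) :=
  .morCode (by fun_prop) hf (by fun_prop)

theorem isIncFun_enum_setCode (hP : Definable N P) :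
    IsIncFun (card (setCode n P)) n (enum (setCode n P)) :=
  isIncFun_enum fun _ hx => ((finMem_setCode hP).1 hx).1

theorem exists_enum_setCode_eq_iff (hP : Definable N P) {x : N} :
    (∃ i < card (setCode n P), enum (setCode n P) i = x) ↔ x < n ∧ P x := by
  rw [← finMem_iff_enum, finMem_setCode hP]

/-- The element `σ` of `D(n)` comes from a morphism into `n` with values in `P`. -/
def SupportedOn (D : Set N) (n : N) (P : N → Prop) (σ : N) : Prop :=
  ∃ m F ρ, IsIncFun m n F ∧ (∀ i < m, P (F i)) ∧ MapTo D (morCode m n F) ρ σ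

theorem SupportedOn.mono (h : SupportedOn D n P σ) (hPQ : ∀ i < n, P i → Q i) :
    SupportedOn D n Q σ :=
  let ⟨m, F, ρ, hF, hP, hρ⟩ := h
  ⟨m, F, ρ, hF, fun i hi => hPQ _ (hF.lt i hi) (hP i hi), hρ⟩

theorem supportedOn_range (hF : IsIncFun m n F) (h : MapTo D (morCode m n F) σ τ) :
    SupportedOn D n (fun j => ∃ i < m, F i = j) τ :=
  ⟨m, F, σ, hF, fun i hi => ⟨i, hi, rfl⟩, h⟩

theorem SupportedOn.mapTo (hD : IsFunctor D) (hF : IsIncFun m n F)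
    (h : MapTo D (morCode m n F) σ τ) (hσ : SupportedOn D m (fun i => P (F i)) σ) :
    SupportedOn D n P τ :=
  let ⟨k, K, ρ, hK, hP, hρ⟩ := hσ
  ⟨k, fun i => F (K i), ρ, hF.comp hK, hP, hD.mapTo_comp hK hF (hF.comp hK) (fun _ _ => rfl) hρ h⟩

namespace IsFunctor

variable (hD : IsFunctor D)

include hD

theorem supportedOn_lt (hσ : ObjMem D n σ) : SupportedOn D n (· < n) σ :=
  ⟨n, _, σ, .id le_rfl, fun _ => id, hD.mapTo_id hσ⟩

theorem exists_mapTo_of_supportedOn (hF : IsIncFun m n F)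
    (h : SupportedOn D n (fun j => ∃ i < m, F i = j) σ) : ∃ ρ, MapTo D (morCode m n F) ρ σ :=
  let ⟨_, _, _, hG, hrange, hρ⟩ := h
  hD.exists_mapTo_of_range hG hF hrange hρ

theorem supportedOn_iff (hP : Definable N P) :
    SupportedOn D n P σ ↔ ∃ ρ, MapTo D (setIncl n (setCode n P)) ρ σ := by
  have hincl : IsIncFun _ n _ := isIncFun_enum_setCode hP
  refine ⟨fun h => hD.exists_mapTo_of_supportedOn hincl (h.mono fun i hi hPi =>
    (exists_enum_setCode_eq_iff hP).2 ⟨hi, hPi⟩), fun ⟨ρ, hρ⟩ => ?_⟩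
  exact (supportedOn_range hincl hρ).mono fun i _ hi => ((exists_enum_setCode_eq_iff hP).1 hi).2

end IsFunctor

namespace IsGoodsteinDilator

variable (hD : IsGoodsteinDilator sets D)

include hD

theorem supportedOn_and (h : SupportedOn D n P σ) (h' : SupportedOn D n Q σ) :
    SupportedOn D n (fun i => P i ∧ Q i) σ := by
  obtain ⟨m, F, ρ, hF, hFP, hρ⟩ := h
  obtain ⟨m', G, ρ', hG, hGQ, hρ'⟩ := h'
  have hFd := hF.definable
  have hGd := hG.definable
  have hinter : Definable N fun x => (∃ i < m, F i = x) ∧ ∃ i < m', G i = x :=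
    .and (.bex (by fun_prop) (by fun_prop)) (.bex (by fun_prop) (by fun_prop))
  have hincl : IsIncFun _ n _ := isIncFun_enum_setCode hinter
  obtain ⟨ρ'', hρ''⟩ := hD.exists_mapTo_of_inter hF hG hincl (fun x => by
    rw [exists_enum_setCode_eq_iff hinter, and_iff_right_iff_imp]
    rintro ⟨⟨i, hi, rfl⟩, -⟩
    exact hF.lt i hi) hρ hρ'
  refine (supportedOn_range hincl hρ'').mono fun x _ hx => ?_
  obtain ⟨-, ⟨i, hi, rfl⟩, j, hj, hij⟩ := (exists_enum_setCode_eq_iff hinter).1 hx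
  exact ⟨hFP i hi, hij ▸ hGQ j hj⟩

theorem supportedOn_mapTo_iff (hF : IsIncFun m n F) (h : MapTo D (morCode m n F) σ τ) :
    SupportedOn D n P τ ↔ SupportedOn D m (fun i => P (F i)) σ := by
  refine ⟨fun hP => ?_, .mapTo hD.isFunctor hF h⟩
  obtain ⟨k, G, ρ, hG, hGP, hρ⟩ := hD.supportedOn_and hP (supportedOn_range hF h)
  obtain ⟨K, hK, hKG⟩ := hG.exists_factor hF fun i hi => (hGP i hi).2
  obtain ⟨σ', hσ'⟩ := hD.isFunctor.exists_mapTo hK (hD.isFunctor.mapTo_dom hG hρ)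
  obtain rfl := hD.mapTo_injective hF h (hD.isFunctor.mapTo_of_comp hK hF hG hKG hσ' hρ)
  exact ⟨k, K, ρ, hK, fun i hi => by simpa only [hKG i hi] using (hGP i hi).1, hσ'⟩

end IsGoodsteinDilator

theorem Definable.supportedOn (hDS : D ∈ sets (N := N)) (hD : IsGoodsteinDilator sets D)
    {f g : α → N} {P : α → N → Prop} (hf : Definable N f)
    (hP : Definable N fun p : α × N => P p.1 p.2) (hg : Definable N g) :
    Definable N fun x => SupportedOn D (f x) (P x) (g x) := by
  have bound (x : α) : SupportedOn D (f x) (P x) (g x) ↔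
      ∃ ρ < g x + 1, MapTo D (SOA.setIncl (f x) (SOA.setCode (f x) (P x))) ρ (g x) := by
    rw [hD.isFunctor.supportedOn_iff (hP.section_right x)]
    exact exists_congr fun ρ => ⟨fun h => ⟨Order.lt_add_one_iff.2
      (hD.le_of_mapTo hDS (isIncFun_enum_setCode (hP.section_right x)) h), h⟩, fun h => h.2⟩
  have hincl := hf.setIncl (hf.setCode hP)
  simp only [bound]
  exact .bex (by fun_prop) (.mapTo hDS (hincl.comp (.fst .id)) (by fun_prop) (by fun_prop))

/-- The support of an element `σ` of `D(n)`: the set of all `i < n` that no morphism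
with `σ` in its range can avoid. -/
noncomputable def supp (D : Set N) (n σ : N) : N :=
  setCode n fun i => ¬ SupportedOn D n (· ≠ i) σ

section

variable (hDS : D ∈ sets (N := N)) (hD : IsGoodsteinDilator sets D)

include hDS hD

theorem Definable.not_supportedOn_ne {f g h : α → N} (hf : Definable N f) (hg : Definable N g)
    (hh : Definable N h) : Definable N fun x => ¬ SupportedOn D (f x) (· ≠ h x) (g x) :=
  .not (.supportedOn hDS hD hf (.not (by fun_prop)) hg)

theorem Definable.supp {f g : α → N} (hf : Definable N f) (hg : Definable N g) :
    Definable N fun x => supp D (f x) (g x) :=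
  .setCode hf (.not_supportedOn_ne hDS hD (by fun_prop) (by fun_prop) (by fun_prop))

theorem isFinSet_supp : IsFinSet (supp D n σ) :=
  isFinSet_setCode (.not_supportedOn_ne hDS hD (by fun_prop) (by fun_prop) (by fun_prop)) n

theorem finMem_supp {i : N} : FinMem i (supp D n σ) ↔ i < n ∧ ¬ SupportedOn D n (· ≠ i) σ :=
  finMem_setCode (.not_supportedOn_ne hDS hD (by fun_prop) (by fun_prop) (by fun_prop))

theorem supportedOn_of_forall_finMem_supp (hP : Definable N P) (hσ : ObjMem D n σ)
    (h : ∀ i, FinMem i (supp D n σ) → P i) : SupportedOn D n P σ := by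
  have key : ∀ k, SupportedOn D n (fun i => P i ∨ k ≤ i) σ := by
    refine definable_induction (.supportedOn hDS hD (by fun_prop)
      (.or (by fun_prop) (by fun_prop)) (by fun_prop))
      ((hD.isFunctor.supportedOn_lt hσ).mono fun _ _ _ => .inr zero_le) fun k ih => ?_
    have step {i : N} (hi : P i ∨ k ≤ i) (hk : i = k → P i) : P i ∨ k + 1 ≤ i :=
      hi.elim .inl fun hki => hki.eq_or_lt.imp (fun h => hk h.symm) Order.add_one_le_iff.2
    by_cases hk : FinMem k (supp D n σ)
    · exact ih.mono fun i _ hi => step hi fun hik => hik ▸ h k hk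
    · by_cases hkn : k < n
      · have avoid : SupportedOn D n (· ≠ k) σ := by
          by_contra hk'
          exact hk ((finMem_supp hDS hD).2 ⟨hkn, hk'⟩)
        exact (hD.supportedOn_and ih avoid).mono fun i _ hi => step hi.1 fun hik => (hi.2 hik).elim
      · exact ih.mono fun i hin hi => step hi fun hik => (hkn (hik ▸ hin)).elim
  exact (key n).mono fun i hi hPi => hPi.resolve_right hi.not_ge

theorem finMem_supp_mapTo (hF : IsIncFun m n F) (h : MapTo D (morCode m n F) σ τ) {j : N} :
    FinMem j (supp D n τ) ↔ ∃ i < m, FinMem i (supp D m σ) ∧ F i = j := by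
  by_cases hj : ∃ i < m, F i = j
  · obtain ⟨i, hi, rfl⟩ := hj
    have avoid_iff : SupportedOn D n (· ≠ F i) τ ↔ SupportedOn D m (· ≠ i) σ :=
      (hD.supportedOn_mapTo_iff hF h).trans
        ⟨fun hσ => hσ.mono fun x _ hx hxi => hx (hxi ▸ rfl),
          fun hσ => hσ.mono fun x hxm hx hxi => hx (hF.inj hxm hi hxi)⟩
    rw [finMem_supp hDS hD, avoid_iff]
    refine ⟨fun hi' => ⟨i, hi, (finMem_supp hDS hD).2 ⟨hi, hi'.2⟩, rfl⟩, ?_⟩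
    rintro ⟨i', hi', hmem, heq⟩
    obtain rfl := hF.inj hi' hi heq
    exact ⟨hF.lt _ hi, ((finMem_supp hDS hD).1 hmem).2⟩
  · refine iff_of_false (fun hmem => ((finMem_supp hDS hD).1 hmem).2 ?_)
      fun ⟨i, hi, _, hij⟩ => hj ⟨i, hi, hij⟩
    exact (supportedOn_range hF h).mono fun x _ hx hxj => hj (hxj ▸ hx)

theorem exists_isSupport : ∃ U ∈ sets (N := N), IsSupport D U := by
  have hU : Definable N fun z : N => ∃ n x, z = pair n x ∧ ∃ σ a, x = pair σ a ∧ a = supp D n σ :=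
    .exPair (by fun_prop) (.exPair (by fun_prop)
      (.eq (by fun_prop) (.supp hDS hD (by fun_prop) (by fun_prop))))
  refine ⟨_, hU.mem_sets, ?_⟩
  have suppTo_iff (n σ a : N) : SuppTo {z | ∃ n x, z = pair n x ∧ ∃ σ a, x = pair σ a ∧
      a = supp D n σ} n σ a ↔ a = supp D n σ := by
    simp [SuppTo, pair_inj]
  constructor <;> simp only [suppTo_iff]
  · exact fun n σ _ => ⟨_, rfl, fun _ h => h⟩
  · rintro n σ _ - rfl
    exact ⟨isFinSet_supp hDS hD, fun i hi => ((finMem_supp hDS hD).1 hi).1⟩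
  · rintro m n f σ τ _ _ hf h rfl rfl j
    obtain ⟨F, hF, rfl⟩ := hf.exists_eq_morCode
    simp only [finMem_supp_mapTo hDS hD hF h, app_morCode hF, eq_comm (a := j)]
    exact exists_congr fun i => and_left_comm
  · rintro m n f σ _ hf hσ rfl h
    obtain ⟨F, hF, rfl⟩ := hf.exists_eq_morCode
    have hFd := hF.definable
    refine hD.isFunctor.exists_mapTo_of_supportedOn hF
      (supportedOn_of_forall_finMem_supp hDS hD (.bex (by fun_prop) (by fun_prop)) hσ
        fun j hj => ?_)
    obtain ⟨i, hi⟩ := h j hj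
    rw [app_morCode hF] at hi
    exact ⟨i, hi.1, hi.2.symm⟩

end

end Support

section Extension

variable {N : Type u} [Model N] {α : Type v} [Codable N α] {D U : Set N}
variable {m n a b u f σ τ ρ σ' τ' : N}

/-! ### The extension to the natural numbers -/

theorem exists_isUnion (a b : N) : ∃ u, IsUnion a b u := by
  have hab : Definable N fun x => FinMem x a ∨ FinMem x b := by fun_prop
  refine ⟨setCode (a + b) fun x => FinMem x a ∨ FinMem x b, isFinSet_setCode hab _, fun x => ?_⟩
  rw [finMem_setCode hab, and_iff_right_iff_imp]
  rintro (h | h)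
  exacts [h.lt.trans_le le_self_add, h.lt.trans_le le_add_self]

theorem exists_isInclMor (ha : IsFinSet a) (hu : IsFinSet u) (hau : ∀ x, FinMem x a → FinMem x u) :
    ∃ H, IsIncFun (card a) (card u) H ∧ IsInclMor (· < ·) a u (morCode (card a) (card u) H) := by
  have hincl : IsIncFun (card a) u (enum a) := isIncFun_enum fun x hx => (hau x hx).lt
  obtain ⟨H, hH, comm⟩ := hincl.exists_factor (isIncFun_enum_self u) fun i hi =>
    finMem_iff_enum.1 (hau _ (finMem_enum hi))
  exact ⟨H, hH, (isInclMor_iff ha hu).2 ⟨H, hH, rfl, comm⟩⟩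

/-- The inclusion of `{0,…,m-1}` into `{0,…,n-1}`, as a morphism of natural numbers. -/
noncomputable def natIncl (m n : N) : N := morCode m n fun i => i

@[fun_prop]
theorem Definable.natIncl {f g : α → N} (hf : Definable N f) (hg : Definable N g) :
    Definable N fun x => natIncl (f x) (g x) :=
  .morCode hf hg (by fun_prop)

theorem IsFunctor.mapTo_setIncl_of_natIncl (hD : IsFunctor D) (hmn : m ≤ n)
    (ha : ∀ x, FinMem x a → x < m) (h : MapTo D (setIncl m a) σ τ)
    (h' : MapTo D (natIncl m n) τ ρ) : MapTo D (setIncl n a) σ ρ :=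
  hD.mapTo_comp (isIncFun_enum ha) (.id hmn) (isIncFun_enum fun x hx => (ha x hx).trans_le hmn)
    (fun _ _ => rfl) h h'

theorem IsFunctor.mapTo_setIncl_of_isInclMor (hD : IsFunctor D) (ha : IsFinSet a) (hu : IsFinSet u)
    (hun : ∀ x, FinMem x u → x < n) (hf : IsInclMor (· < ·) a u f) (h : MapTo D f σ τ)
    (h' : MapTo D (setIncl n a) σ ρ) : MapTo D (setIncl n u) τ ρ := by
  obtain ⟨H, hH, rfl, comm⟩ := (isInclMor_iff ha hu).1 hf
  have hincl : IsIncFun (card a) n (enum a) := isIncFun_enum fun x hx => by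
    obtain ⟨i, hi, rfl⟩ := finMem_iff_enum.1 hx
    exact comm i hi ▸ hun _ (finMem_enum (hH.lt i hi))
  exact hD.mapTo_of_comp hH (isIncFun_enum hun) hincl comm h h'

theorem extLt_iff (hD : IsGoodsteinDilator sets D) (ha : IsFinSet a) (hb : IsFinSet b)
    (han : ∀ x, FinMem x a → x < n) (hbn : ∀ x, FinMem x b → x < n)
    (h : MapTo D (setIncl n a) σ σ') (h' : MapTo D (setIncl n b) τ τ') :
    ExtLt D (· < ·) (pair a σ) (pair b τ) ↔ σ' < τ' := by
  have hfun := hD.isFunctor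
  have hun {u : N} (hu : IsUnion a b u) (x : N) (hx : FinMem x u) : x < n :=
    ((hu.2 x).1 hx).elim (han x) (hbn x)
  constructor
  · rintro ⟨a', σ₀, b', τ₀, u, d, f, g, σ₁, τ₁, haσ, hbτ, hu, hd, hf, hg, hσ, hτ, hlt⟩
    obtain ⟨rfl, rfl⟩ := pair_inj.1 haσ
    obtain ⟨rfl, rfl⟩ := pair_inj.1 hbτ
    obtain rfl := (isCard_iff hu.1).1 hd
    have hσ₁ := hfun.mapTo_setIncl_of_isInclMor ha hu.1 (hun hu) hf hσ h
    have hτ₁ := hfun.mapTo_setIncl_of_isInclMor hb hu.1 (hun hu) hg hτ h'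
    have hincl : IsIncFun _ n _ := isIncFun_enum (hun hu)
    rw [hD.usual_order _ _ _ (hfun.mapTo_dom hincl hσ₁) (hfun.mapTo_dom hincl hτ₁)] at hlt
    exact hD.mapTo_lt hincl hσ₁ hτ₁ hlt
  · intro hlt
    obtain ⟨u, hu⟩ := exists_isUnion a b
    obtain ⟨F, hF, hf⟩ := exists_isInclMor ha hu.1 fun x hx => (hu.2 x).2 (.inl hx)
    obtain ⟨G, hG, hg⟩ := exists_isInclMor hb hu.1 fun x hx => (hu.2 x).2 (.inr hx)
    obtain ⟨σ₁, hσ⟩ := hfun.exists_mapTo hF (hfun.mapTo_dom (isIncFun_enum han) h)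
    obtain ⟨τ₁, hτ⟩ := hfun.exists_mapTo hG (hfun.mapTo_dom (isIncFun_enum hbn) h')
    refine ⟨a, σ, b, τ, u, card u, _, _, σ₁, τ₁, rfl, rfl, hu, (isCard_iff hu.1).2 rfl, hf, hg,
      hσ, hτ, (hD.usual_order _ _ _ (hfun.mapTo_cod hF hσ) (hfun.mapTo_cod hG hτ)).2 ?_⟩
    exact hD.lt_of_mapTo_lt (isIncFun_enum (hun hu))
      (hfun.mapTo_setIncl_of_isInclMor ha hu.1 (hun hu) hf hσ h)
      (hfun.mapTo_setIncl_of_isInclMor hb hu.1 (hun hu) hg hτ h') hlt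

theorem ExtMem.exists_eq_pair {A : N → Prop} {z : N} (h : ExtMem D U A (· < ·) z) :
    ∃ a σ, z = pair a σ ∧ IsFinSet a ∧ ObjMem D (card a) σ := by
  obtain ⟨a, σ, c, -, hz, ha, -, hc, hσ, -⟩ := h
  exact ⟨a, σ, hz, ha, (isCard_iff ha).1 hc ▸ hσ⟩

namespace IsSupport

variable (hU : IsSupport D U)

include hU

theorem exists_mapTo_setIncl (hσ : ObjMem D n σ) :
    ∃ a ρ, SuppTo U n σ a ∧ MapTo D (setIncl n a) ρ σ := by
  obtain ⟨a, ha, -⟩ := hU.total n σ hσ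
  have hincl : IsIncFun _ n _ := isIncFun_enum (hU.finSubset n σ a hσ ha).2
  obtain ⟨ρ, hρ⟩ := hU.range _ n _ σ a hincl.isMor hσ ha fun j hj =>
    let ⟨i, hi, hij⟩ := finMem_iff_enum.1 hj
    ⟨i, (app_morCode hincl).2 ⟨hi, hij.symm⟩⟩
  exact ⟨a, ρ, ha, hρ⟩

theorem extMem_pair (hD : IsFunctor D) (hσ : ObjMem D n σ) (ha : SuppTo U n σ a)
    (hρ : MapTo D (setIncl n a) ρ σ) : ExtMem D U (fun _ => True) (· < ·) (pair a ρ) := by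
  obtain ⟨hfin, hlt⟩ := hU.finSubset n σ a hσ ha
  have hincl : IsIncFun _ n _ := isIncFun_enum hlt
  have hρc := hD.mapTo_dom hincl hρ
  obtain ⟨w, hw, -⟩ := hU.total _ ρ hρc
  refine ⟨a, ρ, card a, w, rfl, hfin, fun _ _ => trivial, (isCard_iff hfin).2 rfl, hρc, hw,
    fun i => ⟨(hU.finSubset _ ρ w hρc hw).2 i, fun hi => ?_⟩⟩
  obtain ⟨j, hj, hij⟩ := (hU.natural _ _ _ _ _ _ _ hincl.isMor hρ hw ha _).1 (finMem_enum hi)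
  rw [app_morCode hincl] at hij
  rwa [hincl.inj hi hij.1 hij.2]

end IsSupport

end Extension

section Functions

variable {N : Type u} [Model N]

/-! ### Definable functions as sets of pairs -/

/-- The graph of a function on numbers as a set of pairs, the form in which functions
appear in `IsFun`. -/
def funSet (f : N → N) : Set N := {z | ∃ x, z = pair x (f x)}

theorem pair_mem_funSet {f : N → N} {x y : N} : pair x y ∈ funSet f ↔ y = f x := by
  simp [funSet, pair_inj]

theorem isFun_funSet (f : N → N) : IsFun (funSet f) := by
  refine ⟨fun z ⟨x, hx⟩ => ⟨x, f x, hx⟩, fun x => ⟨f x, pair_mem_funSet.2 rfl, fun y hy => ?_⟩⟩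
  exact pair_mem_funSet.1 hy

theorem Definable.funSet_mem_sets {f : N → N} (hf : Definable N f) : funSet f ∈ sets := by
  have hgraph : Definable N fun z : N => ∃ x y, z = pair x y ∧ y = f x :=
    .exPair (by fun_prop) (by fun_prop)
  simpa [funSet] using hgraph.mem_sets

theorem IsFun.exists_eq_funSet {F : Set N} (hF : IsFun F) (hFS : F ∈ sets) :
    ∃ f, Definable N f ∧ F = funSet f := by
  obtain ⟨f, hf, hfF⟩ := exists_definable (P := fun x y => pair x y ∈ F)
    (by fun_prop (disch := assumption)) fun x => (hF.2 x).exists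
  refine ⟨f, hf, Set.ext fun z => ⟨fun hz => ?_, fun ⟨x, hz⟩ => hz ▸ hfF x⟩⟩
  obtain ⟨x, y, rfl⟩ := hF.1 z hz
  exact ⟨x, by rw [(hF.2 x).unique hz (hfF x)]⟩

theorem le_of_forall_le_add_one {b : N → N} (hb : Definable N b) (hmono : ∀ i, b i ≤ b (i + 1))
    {i j : N} (hij : i ≤ j) : b i ≤ b j := by
  have key : ∀ k, b i ≤ b (i + k) :=
    definable_induction (by fun_prop) (by rw [add_zero]) fun k ih =>
      ih.trans (by simpa only [add_assoc] using hmono (i + k))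
  obtain ⟨k, rfl⟩ := exists_add_of_le hij
  exact key k

theorem isBase_funSet_iff {b : N → N} (hb : Definable N b) :
    IsBase (funSet b) ↔ (∀ i, b i ≤ b (i + 1)) ∧ 0 < b 0 := by
  simp only [IsBase, isFun_funSet, pair_mem_funSet, true_and, ← le_iff_lt_or_eq]
  refine ⟨fun h => ⟨fun i => h.1 i _ _ _ (lt_add_one i) rfl rfl, h.2 _ rfl⟩, fun h => ⟨?_, ?_⟩⟩
  · rintro i j _ _ hij rfl rfl
    exact le_of_forall_le_add_one hb h.1 hij.le
  · rintro _ rfl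
    exact h.2

theorem exists_mono_gt {z : N → N} (hz : Definable N z) :
    ∃ b : N → N, Definable N b ∧ (∀ i, b i ≤ b (i + 1)) ∧ ∀ i, z i < b i := by
  obtain ⟨F, hF, hF0, hFs⟩ := exists_recursion (α := N) (g := fun _ => z 0 + 1)
    (h := fun _ i x => x + (z (i + 1) + 1)) (by fun_prop) (by fun_prop)
  refine ⟨F 0, hF.section_right 0, fun i => (hFs 0 i).symm ▸ le_self_add, fun i => ?_⟩
  obtain rfl | hi := eq_or_ne i 0
  · exact (hF0 0).symm ▸ lt_add_one _
  · obtain ⟨i, rfl⟩ := exists_eq_add_one hi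
    exact (hFs 0 i).symm ▸ (lt_add_one _).trans_le le_add_self

end Functions

section Descent

variable {N : Type u} [Model N] {D U : Set N} {b e g : N → N} {k : N}

/-! ### Descents and Goodstein sequences -/

/-- The functions `b` and `e` form a descent for `D`: the base `b` is non-decreasing with
`0 < b 0`, and `e i ∈ D(b i)` satisfies `e (i + 1) < D(c)(e i)` for the inclusion
`c : b i → b (i + 1)`. Both Goodstein sequences that avoid zero and descending sequences in the
extension of `D` are of this form. -/
structure IsDescent (D : Set N) (b e : N → N) : Prop where
  definable_base : Definable N b
  base_le : ∀ i, b i ≤ b (i + 1)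
  base_pos : 0 < b 0
  definable : Definable N e
  mem : ∀ i, ObjMem D (b i) (e i)
  lt : ∀ i x, MapTo D (natIncl (b i) (b (i + 1))) (e i) x → e (i + 1) < x

/-- The defining equations `G(i+1) = 0` if `G(i) = 0` and `G(i+1) + 1 = D(c)(G(i))` otherwise,
for the functions `b` and `g` instead of their graphs. -/
def IsGoodsteinStep (D : Set N) (b g : N → N) : Prop :=
  ∀ i, (g i = 0 → g (i + 1) = 0) ∧
    (g i ≠ 0 → MapTo D (natIncl (b i) (b (i + 1))) (g i) (g (i + 1) + 1))

theorem isGoodsteinSeq_funSet_iff (hb : ∀ i, b i ≤ b (i + 1)) :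
    IsGoodsteinSeq D (funSet b) k (funSet g) ↔ g 0 = k ∧ IsGoodsteinStep D b g := by
  have hincl (i : N) : IsIncFun (b i) (b (i + 1)) fun i => i := .id (hb i)
  simp only [IsGoodsteinSeq, isFun_funSet, pair_mem_funSet, true_and, eq_comm (a := k)]
  refine and_congr_right fun _ => ⟨fun h i => ?_, ?_⟩
  · refine ⟨(h i _ _ rfl rfl).1, fun hi => ?_⟩
    obtain ⟨_, _, c, _, rfl, rfl, hc, hincl, hτ, rfl⟩ := (h i _ _ rfl rfl).2 hi
    obtain ⟨C, hC, rfl⟩ := hc.exists_eq_morCode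
    rwa [morCode_congr ((isIncl_morCode hC).1 hincl)] at hτ
  · rintro h i _ _ rfl rfl
    exact ⟨(h i).1, fun hi => ⟨_, _, _, _, rfl, rfl, (hincl i).isMor,
      (isIncl_morCode (hincl i)).2 fun _ _ => rfl, (h i).2 hi, rfl⟩⟩

namespace IsGoodsteinDilator

variable (hD : IsGoodsteinDilator sets D)

include hD

theorem exists_goodsteinSucc {m n x : N} (hmn : m ≤ n) (hx : ObjMem D m x) :
    ∃ y, ObjMem D n y ∧ (x = 0 → y = 0) ∧ (x ≠ 0 → MapTo D (natIncl m n) x (y + 1)) := by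
  have hincl : IsIncFun m n fun i => i := .id hmn
  have zero_mapTo := hD.mapTo_zero hincl
  by_cases hx0 : x = 0
  · exact ⟨0, hD.isFunctor.mapTo_cod hincl zero_mapTo, fun _ => rfl, fun h => (h hx0).elim⟩
  · obtain ⟨τ, hτ⟩ := hD.isFunctor.exists_mapTo hincl hx
    have hpos : 0 < τ := hD.mapTo_lt hincl zero_mapTo hτ (pos_iff_ne_zero.2 hx0)
    obtain ⟨y, rfl⟩ := exists_eq_add_one hpos.ne'
    exact ⟨y, hD.initial _ _ _ (hD.isFunctor.mapTo_cod hincl hτ) (lt_add_one y),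
      fun h => (hx0 h).elim, fun _ => hτ⟩

theorem exists_isGoodsteinStep (hDS : D ∈ sets (N := N)) (hb : Definable N b)
    (hmono : ∀ i, b i ≤ b (i + 1)) (hk : ObjMem D (b 0) k) :
    ∃ g, Definable N g ∧ g 0 = k ∧ (∀ i, ObjMem D (b i) (g i)) ∧ IsGoodsteinStep D b g := by
  obtain ⟨succ, hsucc, succ_spec⟩ := exists_definable (α := N × N)
    (P := fun p y => ObjMem D (b p.1) p.2 → ObjMem D (b (p.1 + 1)) y ∧ (p.2 = 0 → y = 0) ∧
      (p.2 ≠ 0 → MapTo D (natIncl (b p.1) (b (p.1 + 1))) p.2 (y + 1)))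
    (.imp (by fun_prop (disch := assumption)) (.and (by fun_prop (disch := assumption))
      (.and (.imp (by fun_prop) (by fun_prop))
        (.imp (.not (by fun_prop)) (by fun_prop (disch := assumption)))))) fun p => by
      by_cases hp : ObjMem D (b p.1) p.2
      · exact (hD.exists_goodsteinSucc (hmono p.1) hp).imp fun _ h _ => h
      · exact ⟨0, fun h => (hp h).elim⟩
  obtain ⟨F, hF, hF0, hFs⟩ := exists_recursion (α := N) (g := fun _ => k)
    (h := fun _ i x => succ (i, x)) (by fun_prop) (by fun_prop)
  have hF' := hF.section_right 0
  have mem : ∀ i, ObjMem D (b i) (F 0 i) := by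
    refine definable_induction (by fun_prop (disch := assumption)) (by rwa [hF0]) fun i ih => ?_
    exact (hFs 0 i).symm ▸ (succ_spec (i, F 0 i) ih).1
  refine ⟨F 0, hF', hF0 0, mem, fun i => ?_⟩
  rw [hFs]
  exact (succ_spec (i, F 0 i) (mem i)).2

end IsGoodsteinDilator

theorem IsGoodsteinStep.isDescent (hD : IsFunctor D) (h : IsGoodsteinStep D b g)
    (hb : Definable N b) (hmono : ∀ i, b i ≤ b (i + 1)) (hpos : 0 < b 0) (hg : Definable N g)
    (mem : ∀ i, ObjMem D (b i) (g i)) (hne : ∀ i, g i ≠ 0) : IsDescent D b g :=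
  ⟨hb, hmono, hpos, hg, mem, fun i x hx => by
    rw [hD.mapTo_unique (.id (hmono i)) hx ((h i).2 (hne i))]
    exact lt_add_one _⟩

namespace IsDescent

variable (h : IsDescent D b e) (hD : IsGoodsteinDilator sets D)

include h hD

theorem pos (i : N) : 0 < e i :=
  pos_iff_ne_zero.2 fun h0 =>
    not_lt_zero (h.lt i 0 (h0 ▸ hD.mapTo_zero (.id (h.base_le i))))

theorem le_goodstein (hg : Definable N g) (hstep : IsGoodsteinStep D b g) (h0 : e 0 ≤ g 0) :
    ∀ i, e i ≤ g i := by
  have he := h.definable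
  refine definable_induction (by fun_prop) h0 fun i ih => ?_
  have hincl : IsIncFun (b i) (b (i + 1)) fun i => i := .id (h.base_le i)
  obtain ⟨x, hx⟩ := hD.isFunctor.exists_mapTo hincl (h.mem i)
  exact Order.lt_add_one_iff.1 ((h.lt i x hx).trans_le
    (hD.mapTo_le hincl hx ((hstep i).2 ((h.pos hD i).trans_le ih).ne') ih))

end IsDescent

theorem goodsteinTerminates_iff (hDS : D ∈ sets (N := N)) (hD : IsGoodsteinDilator sets D) :
    GoodsteinTerminates sets D ↔ ¬ ∃ b e, IsDescent D b e := by
  constructor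
  · rintro hterm ⟨b, e, h⟩
    have hbase := (isBase_funSet_iff h.definable_base).2 ⟨h.base_le, h.base_pos⟩
    obtain ⟨G, hGS, hG, i, hi⟩ := hterm _ h.definable_base.funSet_mem_sets hbase (b 0) (e 0)
      (pair_mem_funSet.2 rfl) (h.mem 0)
    obtain ⟨g, hg, rfl⟩ := hG.1.exists_eq_funSet hGS
    obtain ⟨hg0, hstep⟩ := (isGoodsteinSeq_funSet_iff h.base_le).1 hG
    exact (h.pos hD i).not_ge
      ((h.le_goodstein hD hg hstep hg0.ge i).trans_eq (pair_mem_funSet.1 hi).symm)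
  · intro hdesc B hBS hB u k hu hk
    obtain ⟨b, hb, rfl⟩ := hB.1.exists_eq_funSet hBS
    obtain ⟨hmono, hpos⟩ := (isBase_funSet_iff hb).1 hB
    obtain rfl := pair_mem_funSet.1 hu
    obtain ⟨g, hg, hg0, mem, hstep⟩ := hD.exists_isGoodsteinStep hDS hb hmono hk
    refine ⟨funSet g, hg.funSet_mem_sets, (isGoodsteinSeq_funSet_iff hmono).2 ⟨hg0, hstep⟩, ?_⟩
    by_contra! hne
    exact hdesc ⟨b, g, hstep.isDescent hD.isFunctor hb hmono hpos hg mem fun i hi =>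
      hne i (pair_mem_funSet.2 hi.symm)⟩

/-! ### Descents and the extension -/

theorem extLt_iff_of_natIncl {m n a a' σ σ' τ τ' ρ : N} (hD : IsGoodsteinDilator sets D)
    (hmn : m ≤ n) (ha : IsFinSet a) (ha' : IsFinSet a') (ham : ∀ x, FinMem x a → x < m)
    (han' : ∀ x, FinMem x a' → x < n) (hσ : MapTo D (setIncl m a) σ τ)
    (hσ' : MapTo D (setIncl n a') σ' τ') (hτ : MapTo D (natIncl m n) τ ρ) :
    ExtLt D (· < ·) (pair a' σ') (pair a σ) ↔ τ' < ρ :=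
  extLt_iff hD ha' ha han' (fun x hx => (ham x hx).trans_le hmn) hσ'
    (hD.isFunctor.mapTo_setIncl_of_natIncl hmn ham hσ hτ)

theorem IsDescent.not_isWellFounded (h : IsDescent D b e) (hDS : D ∈ sets (N := N))
    (hD : IsGoodsteinDilator sets D) (hUS : U ∈ sets (N := N)) (hU : IsSupport D U) :
    ¬ IsWellFounded sets (ExtMem D U (fun _ => True) (· < ·)) (ExtLt D (· < ·)) := by
  have hb := h.definable_base
  have he := h.definable
  obtain ⟨a, ρ, hda, hdρ, haρ⟩ := exists_definable_pair (α := N)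
    (P := fun i a ρ => SuppTo U (b i) (e i) a ∧ MapTo D (setIncl (b i) a) ρ (e i))
    (.and (by unfold SuppTo; fun_prop (disch := assumption)) (by fun_prop (disch := assumption)))
    fun i => hU.exists_mapTo_setIncl (h.mem i)
  have hfin (i : N) := hU.finSubset _ _ _ (h.mem i) (haρ i).1
  refine fun hwf => hwf ⟨funSet fun i => pair (a i) (ρ i),
    Definable.funSet_mem_sets (by fun_prop), isFun_funSet _, ?_, ?_⟩ <;>
    simp only [pair_mem_funSet]
  · rintro i _ rfl
    exact hU.extMem_pair hD.isFunctor (h.mem i) (haρ i).1 (haρ i).2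
  · rintro i _ _ rfl rfl
    obtain ⟨x, hx⟩ := hD.isFunctor.exists_mapTo (.id (h.base_le i)) (h.mem i)
    exact (extLt_iff_of_natIncl hD (h.base_le i) (hfin i).1 (hfin (i + 1)).1 (hfin i).2
      (hfin (i + 1)).2 (haρ i).2 (haρ (i + 1)).2 hx).2 (h.lt i x hx)

theorem exists_isDescent {A : N → Prop} (hDS : D ∈ sets (N := N))
    (hD : IsGoodsteinDilator sets D)
    (h : ¬ IsWellFounded sets (ExtMem D U A (· < ·)) (ExtLt D (· < ·))) :
    ∃ b e, IsDescent D b e := by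
  obtain ⟨Z, hZS, hZ, mem, desc⟩ := not_not.1 h
  obtain ⟨z, hz, rfl⟩ := hZ.exists_eq_funSet hZS
  simp only [pair_mem_funSet, forall_eq] at mem desc
  obtain ⟨a, σ, ha, hσ, haσ⟩ := exists_definable_pair (α := N) (P := fun i a σ => z i = pair a σ)
    (by fun_prop) fun i => let ⟨a, σ, hz, _⟩ := (mem i).exists_eq_pair; ⟨a, σ, hz⟩
  have hmem (i : N) : IsFinSet (a i) ∧ ObjMem D (card (a i)) (σ i) := by
    obtain ⟨a', σ', hz', hfin, hobj⟩ := (mem i).exists_eq_pair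
    obtain ⟨rfl, rfl⟩ := pair_inj.1 ((haσ i).symm.trans hz')
    exact ⟨hfin, hobj⟩
  obtain ⟨b, hb, hmono, hzb⟩ := exists_mono_gt hz
  have hab (i x : N) (hx : FinMem x (a i)) : x < b i :=
    (hx.lt.trans_le ((left_le_pair _ _).trans_eq (haσ i).symm)).trans (hzb i)
  have hincl (i : N) : IsIncFun (card (a i)) (b i) (enum (a i)) := isIncFun_enum (hab i)
  obtain ⟨e, he, hσe⟩ := exists_definable (P := fun i x => MapTo D (setIncl (b i) (a i)) (σ i) x)
    (by fun_prop (disch := assumption)) fun i => hD.isFunctor.exists_mapTo (hincl i) (hmem i).2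
  refine ⟨b, e, hb, hmono, zero_le.trans_lt (hzb 0), he,
    fun i => hD.isFunctor.mapTo_cod (hincl i) (hσe i), fun i x hx => ?_⟩
  have hlt := desc i _ _ rfl rfl
  rw [haσ i, haσ (i + 1)] at hlt
  exact (extLt_iff_of_natIncl hD (hmono i) (hmem i).1 (hmem (i + 1)).1 (hab i) (hab (i + 1))
    (hσe i) (hσe (i + 1)) hx).1 hlt

theorem extNatWellFounded_iff (hDS : D ∈ sets (N := N)) (hD : IsGoodsteinDilator sets D) :
    ExtNatWellFounded sets D ↔ ¬ ∃ b e, IsDescent D b e := by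
  constructor
  · rintro ⟨U, hUS, hU, hwf⟩ ⟨b, e, h⟩
    exact h.not_isWellFounded hDS hD hUS hU hwf
  · intro hdesc
    obtain ⟨U, hUS, hU⟩ := exists_isSupport hDS hD
    exact ⟨U, hUS, hU, by_contra fun h => hdesc (exists_isDescent hDS hD h)⟩

end Descent

end SOA

theorem theorem2 {N : Type u} [SOA.NumStr N] (S : Set (Set N)) (hS : SOA.ModelsRCA0 S)
    (D : Set N) (hDS : D ∈ S) (hD : SOA.IsGoodsteinDilator S D) :
    SOA.GoodsteinTerminates S D ↔ SOA.ExtNatWellFounded S D := by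
  let _ : SOA.Model N := { sets := S, models := hS }
  exact (SOA.goodsteinTerminates_iff hDS hD).trans (SOA.extNatWellFounded_iff hDS hD).symm
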